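/- Let $f_{21},f_{31}$ be smooth function-germs at $0\in\mathbb R$, $f_{24},f_{33},f_{34}$ smooth function-germs in $(u,s)$ at $0\in\mathbb R^2$, and $f_{32}$ a smooth function-germ in $(u,v,s)$ at $0\in\mathbb R^3$, with $f_{32}(0,0,0)=0$, $f_{33}(0,s)=s$ and $(f_{33})_u(0,0)=0$. Let $$f^s(u,v)=\bigl(u,\;u^2f_{21}(u)+v^2+us\,f_{24}(u,s),\;u^2f_{31}(u)+v^2f_{32}(u,v,s)+v\,f_{33}(u,s)+us\,f_{34}(u,s)\bigr)$$ be the normal form of a deformation of an $S_1^\pm$ singularity. Write $$f_{33}(u,s)=s+us\,c_1(s)+u^2c_2(s)+u^3c_3(s)+u^4c_4(u,s),\qquad f_{32}=u\,d_1+v\,d_2+s\,d_3,$$ and assume $c_2(0)=c_{20}^2$ with $c_{20}\neq 0$. Put $s=-\tilde s^2$. Then there is a smooth function-germ $u(\tilde s)$ with $u(0)=0$, $u'(0)=1/c_{20}$ such that near the origin the singular points of $f^{-\tilde s^2}$ are exactly $(u(\tilde s),0)$ and $(u(-\tilde s),0)$; for small $\tilde s\ne0$ these are two distinct points, and $f^{-\tilde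 s^2}$ satisfies Whitney's criterion for a Whitney umbrella there: $f_u,f_{uv},f_{vv}$ are linearly independent and $f_v=0$. For small $\tilde s\neq0$ let $a_{20}(\tilde s),a_{11}(\tilde s),a_{02}(\tilde s)$ be the Bruce–West invariants of $f^{-\tilde s^2}$ at $p=(u(\tilde s),0)$. That is, there are a diffeomorphism-germ $\phi:(\mathbb R^2,0)\to(\mathbb R^2,p)$ and $T\in SO(3)$ such that $$T\bigl(f^{-\tilde s^2}(\phi(x,y))-f^{-\tilde s^2}(p)\bigr)=\Bigl(x,\;xy+O(3),\;\tfrac12\bigl(a_{20}x^2+2a_{11}xy+a_{02}y^2\bigr)+O(3)\Bigr),$$ where the signs are normalized by $a_{02}>0$ and $\partial\phi_1/\partial x(0)>0$. With this normalization the invariants exist and are unique. They have the expansions $$a_{20}(\tilde s)=\frac1{\tilde s^2}\Bigl(\frac{f_{31}(0)^2}{2c_{20}^2}-\frac{f_{31}(0)\bigl(f_{31}(0)c_3(0)-c_{20}^2(3(f_{31})_u(0)-d_1(0,0,0)f_{21}(0))\bigr)}{c_{20}^5}\,\tilde s+O(2)\Bigr),$$ $$a_{11}(\tilde s)=\frac1{\tilde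 s^2}\Bigl(\frac{f_{31}(0)}{2c_{20}^2}-\frac{2c_3(0)f_{31}(0)-c_{20}^2(3(f_{31})_u(0)-d_1(0,0,0)f_{21}(0))}{2c_{20}^5}\,\tilde s+O(2)\Bigr),$$ $$a_{02}(\tilde s)=\frac1{\tilde s^2}\Bigl(\frac1{2c_{20}^2}+O(1)\Bigr),$$ where $O(n)$ denotes a smooth function-germ at $0$ all of whose Taylor terms have degree at least $n$. -/

import Mathlib

open Filter Topology Asymptotics
open scoped Matrix ContDiff

noncomputable section

/-- `f` is smooth on a neighbourhood of `x`, i.e. it represents a `C^∞` map-germ at `x`. -/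
def IsSmoothGerm {E F : Type*} [NormedAddCommGroup E] [NormedSpace ℝ E]
    [NormedAddCommGroup F] [NormedSpace ℝ F] (f : E → F) (x : E) : Prop :=
  ∀ᶠ y in 𝓝 x, ContDiffAt ℝ ∞ f y

/-- `r` is a term `O(n)`: a smooth function-germ at `0` all of whose Taylor terms have
degree at least `n`. -/
def IsTermO {E : Type*} [NormedAddCommGroup E] [NormedSpace ℝ E] (n : ℕ) (r : E → ℝ) : Prop :=
  IsSmoothGerm r 0 ∧ r =O[𝓝 0] (fun x => ‖x‖ ^ n)

/-- The data of a normal form of the deformations of an `S₁^±` singularity. Points of `ℝ × ℝ` in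
the arguments of `f24, f33, f34` are `(u, s)`, points in the argument of `f32` are `(u, v, s)`. -/
structure NormalForm where
  f21 : ℝ → ℝ
  f31 : ℝ → ℝ
  f24 : ℝ × ℝ → ℝ
  f33 : ℝ × ℝ → ℝ
  f34 : ℝ × ℝ → ℝ
  f32 : ℝ × ℝ × ℝ → ℝ
  smooth21 : IsSmoothGerm f21 0
  smooth31 : IsSmoothGerm f31 0
  smooth24 : IsSmoothGerm f24 0
  smooth33 : IsSmoothGerm f33 0
  smooth34 : IsSmoothGerm f34 0
  smooth32 : IsSmoothGerm f32 0
  f32_zero : f32 (0, 0, 0) = 0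
  f33_axis : ∀ᶠ s in 𝓝 (0 : ℝ), f33 (0, s) = s
  f33_u_zero : deriv (fun u => f33 (u, 0)) 0 = 0

namespace NormalForm

/-- The map `f^s : (u, v) ↦ f(u, v, s)` given by the normal form. -/
def map (N : NormalForm) (s : ℝ) (p : ℝ × ℝ) : Fin 3 → ℝ :=
  ![p.1,
    p.1 ^ 2 * N.f21 p.1 + p.2 ^ 2 + p.1 * s * N.f24 (p.1, s),
    p.1 ^ 2 * N.f31 p.1 + p.2 ^ 2 * N.f32 (p.1, p.2, s) + p.2 * N.f33 (p.1, s)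
      + p.1 * s * N.f34 (p.1, s)]

/-- The value `c₂(0)` in `f33(u,s) = s + u s c₁(s) + u² c₂(s) + u³ c₃(s) + u⁴ c₄(u,s)`. -/
def c2 (N : NormalForm) : ℝ := iteratedDeriv 2 (fun u => N.f33 (u, 0)) 0 / 2

/-- The value `c₃(0)` in `f33(u,s) = s + u s c₁(s) + u² c₂(s) + u³ c₃(s) + u⁴ c₄(u,s)`. -/
def c3 (N : NormalForm) : ℝ := iteratedDeriv 3 (fun u => N.f33 (u, 0)) 0 / 6

/-- The value `d₁(0,0,0)` in `f32(u,v,s) = u d₁(u,v,s) + v d₂(u,v,s) + s d₃(u,v,s)`. -/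
def d1 (N : NormalForm) : ℝ := deriv (fun u => N.f32 (u, 0, 0)) 0

end NormalForm

/-- `p` is a singular point of `f`: the differential at `p` is not injective. -/
def IsSingularPoint (f : ℝ × ℝ → Fin 3 → ℝ) (p : ℝ × ℝ) : Prop :=
  ¬ Function.Injective (fderiv ℝ f p)

/-- `f` has a Whitney umbrella at `p`, in Whitney's form: `df_p` has a kernel vector `η`, and there
is a vector `ξ` such that `f_ξ, f_ξη, f_ηη` are linearly independent at `p`. -/
def IsWhitneyUmbrella (f : ℝ × ℝ → Fin 3 → ℝ) (p : ℝ × ℝ) : Prop :=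
  IsSmoothGerm f p ∧ ∃ ξ η : ℝ × ℝ, fderiv ℝ f p η = 0 ∧
    LinearIndependent ℝ ![fderiv ℝ f p ξ, fderiv ℝ (fderiv ℝ f) p ξ η,
      fderiv ℝ (fderiv ℝ f) p η η]

/-- `a20, a11, a02` are the Bruce–West invariants of `f` at `p`: for some diffeomorphism-germ
`φ : (ℝ², 0) → (ℝ², p)` and some `T ∈ SO(3)`,
`T ∘ (f - f(p)) ∘ φ = (u, uv + O(3), (a20 u² + 2 a11 uv + a02 v²) / 2 + O(3))`.
This form determines the coefficients only up to the simultaneous change of sign of all three and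
the change of sign of `a11`, which come from `(u, v) ↦ (-u, -v)` and `(u, v) ↦ (-u, v)`. The two
signs are fixed by `a02 > 0` and by the requirement that `φ` preserves the direction of the
first coordinate. -/
def HasBruceWestInvariants (f : ℝ × ℝ → Fin 3 → ℝ) (p : ℝ × ℝ) (a20 a11 a02 : ℝ) : Prop :=
  0 < a02 ∧
  ∃ φ : ℝ × ℝ → ℝ × ℝ, IsSmoothGerm φ 0 ∧ φ 0 = p ∧ Function.Bijective (fderiv ℝ φ 0) ∧
    0 < (fderiv ℝ φ 0 (1, 0)).1 ∧
  ∃ T ∈ Matrix.specialOrthogonalGroup (Fin 3) ℝ,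
  ∃ r₂ r₃ : ℝ × ℝ → ℝ, IsTermO 3 r₂ ∧ IsTermO 3 r₃ ∧
    ∀ᶠ x in 𝓝 (0 : ℝ × ℝ), T *ᵥ (f (φ x) - f p) =
      ![x.1, x.1 * x.2 + r₂ x,
        (a20 * x.1 ^ 2 + 2 * a11 * (x.1 * x.2) + a02 * x.2 ^ 2) / 2 + r₃ x]

end

noncomputable section

/-! The first component of `f^s` is `u`, so a point is singular exactly when `f_v = 0`, which for
the normal form means `v = 0` and `f33(u, s) = 0`. Hadamard's lemma gives `f33 = u² A(u) + s B(u,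
s)` with `A(0) = c20²` and `B(0) = 1`. For `s = -t²` and smooth roots `a² = A`, `b² = B` this
factors as `(u a - t b)(u a + t b)`. The inverse function theorem solves `u a = t b` by a curve
`u(t)`; as `b` is evaluated at `(u, -t²)`, the other factor vanishes along `u(-t)`
(`exists_singular_curve`).

At `(u(t), 0)` the 2-jet is `(x, g1 x + g2 x²/2 + y², h1 x + h2 x²/2 + m x y + k y²)` with `m =
(f33)_u = t M(t)` and `M(0) = 2 c20` (`hasUmbrellaJet_map`), and Whitney's criterion follows from `m
≠ 0`. In the Bruce–West form the rotation must send `(1, g1, h1)` to the positive first axis and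
remove `y²` from the second component; together with `a02 > 0` this leaves one matrix,
`umbrellaRotation`. The linear part of `φ` is then forced too, and its second-order part does not
reach the 2-jet of the last two components, whose rows annihilate `(1, g1, h1)`. Hence the
invariants are explicit functions of the jet (`HasBruceWestInvariants.eq_of_hasUmbrellaJet`,
`HasUmbrellaJet.hasBruceWestInvariants`).

The pole `1/t²` comes from `m²`. Multiplied by `t²` the invariants are smooth in `t`, and since `E`
and `D` are `1 + O(2)`, they agree to the required order with `(h2 - k g2)²/(2M²)`, `(h2 - k g2)/M²`
and `2/M²` (`umbrella_expansions`). The coefficients then follow from `M'(0) = 2 c3/c20²`, `h2'(0) =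
6 f31'(0)/c20` and `k'(0) = d1/c20`. -/

theorem tendsto_add_nhds_zero {E : Type*} [NormedAddCommGroup E] (p : E) :
    Tendsto (fun h : E => p + h) (𝓝 0) (𝓝 p) := by
  have : ContinuousAt (fun h : E => p + h) 0 := by fun_prop
  simpa [ContinuousAt] using this

theorem eventually_nhds_zero_add {E : Type*} [NormedAddCommGroup E] {p : E} {P : E → Prop}
    (h : ∀ᶠ y in 𝓝 p, P y) : ∀ᶠ y in 𝓝 (0 : E), P (p + y) :=
  (tendsto_add_nhds_zero p).eventually h

/-! ### Calculus of smooth germs -/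

section Germs

variable {E F G : Type*} [NormedAddCommGroup E] [NormedSpace ℝ E]
  [NormedAddCommGroup F] [NormedSpace ℝ F] [NormedAddCommGroup G] [NormedSpace ℝ G]

theorem ContDiff.isSmoothGerm {f : E → F} (hf : ContDiff ℝ ∞ f) (x : E) : IsSmoothGerm f x :=
  Eventually.of_forall fun _ => hf.contDiffAt

namespace IsSmoothGerm

variable {f g : E → F} {x : E}

theorem contDiffAt (hf : IsSmoothGerm f x) : ContDiffAt ℝ ∞ f x := hf.self_of_nhds

theorem continuousAt (hf : IsSmoothGerm f x) : ContinuousAt f x := hf.contDiffAt.continuousAt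

theorem differentiableAt (hf : IsSmoothGerm f x) : DifferentiableAt ℝ f x :=
  hf.contDiffAt.differentiableAt (by simp)

theorem eventually_isSmoothGerm (hf : IsSmoothGerm f x) : ∀ᶠ y in 𝓝 x, IsSmoothGerm f y :=
  eventually_eventually_nhds.2 hf

protected theorem congr (hf : IsSmoothGerm f x) (h : g =ᶠ[𝓝 x] f) : IsSmoothGerm g x := by
  filter_upwards [hf, h.eventuallyEq_nhds] with y hy hy' using hy.congr_of_eventuallyEq hy'

protected theorem comp {g : F → G} {f : E → F} {x : E} (hg : IsSmoothGerm g (f x))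
    (hf : IsSmoothGerm f x) : IsSmoothGerm (fun y => g (f y)) x := by
  filter_upwards [hf, hf.continuousAt.eventually hg] with y hy hy' using hy'.comp y hy

theorem comp' {g : F → G} {f : E → F} {x : E} {y : F} (hg : IsSmoothGerm g y)
    (hf : IsSmoothGerm f x) (h : f x = y) : IsSmoothGerm (fun z => g (f z)) x :=
  IsSmoothGerm.comp (h ▸ hg) hf

protected theorem add (hf : IsSmoothGerm f x) (hg : IsSmoothGerm g x) :
    IsSmoothGerm (fun y => f y + g y) x := by
  filter_upwards [hf, hg] with y h h' using h.add h'

protected theorem sub (hf : IsSmoothGerm f x) (hg : IsSmoothGerm g x) :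
    IsSmoothGerm (fun y => f y - g y) x := by
  filter_upwards [hf, hg] with y h h' using h.sub h'

protected theorem neg (hf : IsSmoothGerm f x) : IsSmoothGerm (fun y => -f y) x := by
  filter_upwards [hf] with y h using h.neg

protected theorem mul {f g : E → ℝ} (hf : IsSmoothGerm f x) (hg : IsSmoothGerm g x) :
    IsSmoothGerm (fun y => f y * g y) x := by
  filter_upwards [hf, hg] with y h h' using h.mul h'

protected theorem pow {f : E → ℝ} (hf : IsSmoothGerm f x) (n : ℕ) :
    IsSmoothGerm (fun y => f y ^ n) x := by
  filter_upwards [hf] with y h using h.pow n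

protected theorem div {f g : E → ℝ} (hf : IsSmoothGerm f x) (hg : IsSmoothGerm g x) (h0 : g x ≠ 0) :
    IsSmoothGerm (fun y => f y / g y) x := by
  filter_upwards [hf, hg, hg.continuousAt.eventually_ne h0] with y h h' h'' using h.div h' h''

protected theorem sqrt {f : E → ℝ} (hf : IsSmoothGerm f x) (h0 : f x ≠ 0) :
    IsSmoothGerm (fun y => √(f y)) x := by
  filter_upwards [hf, hf.continuousAt.eventually_ne h0] with y h h' using h.sqrt h'

protected theorem const (c : F) (x : E) : IsSmoothGerm (fun _ : E => c) x := contDiff_const.isSmoothGerm x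

protected theorem id (x : E) : IsSmoothGerm (fun y : E => y) x := contDiff_id.isSmoothGerm x

protected theorem prodMk {g : E → G} (hf : IsSmoothGerm f x) (hg : IsSmoothGerm g x) :
    IsSmoothGerm (fun y => (f y, g y)) x := by
  filter_upwards [hf, hg] with y h h' using h.prodMk h'

protected theorem pi {ι : Type*} [Fintype ι] {f : E → ι → ℝ} (hf : ∀ i, IsSmoothGerm (fun y => f y i) x) :
    IsSmoothGerm f x := by
  filter_upwards [eventually_all.2 hf] with y h using contDiffAt_pi.2 h

protected theorem apply {ι : Type*} [Fintype ι] {f : E → ι → ℝ} (hf : IsSmoothGerm f x) (i : ι) :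
    IsSmoothGerm (fun y => f y i) x := by
  filter_upwards [hf] with y h using contDiffAt_pi.1 h i

protected theorem fst {f : E → F × G} (hf : IsSmoothGerm f x) : IsSmoothGerm (fun y => (f y).1) x := by
  filter_upwards [hf] with y h using h.fst

protected theorem snd {f : E → F × G} (hf : IsSmoothGerm f x) : IsSmoothGerm (fun y => (f y).2) x := by
  filter_upwards [hf] with y h using h.snd

protected theorem fderiv (hf : IsSmoothGerm f x) : IsSmoothGerm (fderiv ℝ f) x := by
  filter_upwards [hf] with y h using h.fderiv_right (by simp)

theorem fderiv_apply (hf : IsSmoothGerm f x) (v : E) :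
    IsSmoothGerm (fun y => fderiv ℝ f y v) x := by
  filter_upwards [hf.fderiv] with y h using h.clm_apply contDiffAt_const

protected theorem deriv {f : ℝ → F} {x : ℝ} (hf : IsSmoothGerm f x) : IsSmoothGerm (deriv f) x := by
  simpa only [fderiv_apply_one_eq_deriv] using hf.fderiv_apply 1

end IsSmoothGerm

/-! ### Taylor expansions -/

/-- Mean value inequality on the closed ball of radius `‖h‖`. It yields the Taylor estimates one
order at a time: the derivative of a remainder is the remainder of the derivative. -/
theorem isBigO_norm_pow_succ_of_fderiv {g : E → F} {n : ℕ}
    (hg : ∀ᶠ h in 𝓝 0, DifferentiableAt ℝ g h) (h0 : g 0 = 0)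
    (hO : fderiv ℝ g =O[𝓝 0] fun h => ‖h‖ ^ n) : g =O[𝓝 0] fun h => ‖h‖ ^ (n + 1) := by
  obtain ⟨C, hC⟩ := hO.bound
  obtain ⟨ε, hε, H⟩ := Metric.eventually_nhds_iff_ball.1 (hg.and hC)
  refine IsBigO.of_bound C ?_
  filter_upwards [Metric.ball_mem_nhds (0 : E) hε] with h hh
  have hsub : Metric.closedBall (0 : E) ‖h‖ ⊆ Metric.ball 0 ε :=
    Metric.closedBall_subset_ball (by simpa using hh)
  have hCnn : ∀ y ∈ Metric.closedBall (0 : E) ‖h‖, ‖fderiv ℝ g y‖ ≤ |C| * ‖h‖ ^ n := by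
    intro y hy
    refine ((H y (hsub hy)).2).trans ?_
    have hy' : ‖y‖ ≤ ‖h‖ := by simpa using hy
    rw [Real.norm_of_nonneg (by positivity)]
    gcongr
    exact le_abs_self C
  have key := (convex_closedBall (0 : E) ‖h‖).norm_image_sub_le_of_norm_fderiv_le
    (fun y hy => (H y (hsub hy)).1) hCnn (x := 0) (y := h) (by simp) (by simp)
  -- The constant from `IsBigO.bound` carries no sign; for `h ≠ 0` the bound at `h` itself forces `0
  -- ≤ C`.
  have hC0 : |C| * ‖h‖ ^ n * ‖h‖ = C * ‖h‖ ^ n * ‖h‖ ∨ h = 0 := by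
    by_cases hh0 : h = 0
    · exact Or.inr hh0
    · left
      have h1 := (H h hh).2
      rw [Real.norm_of_nonneg (by positivity)] at h1
      have : 0 ≤ C := by
        by_contra hneg
        push Not at hneg
        have : 0 < ‖h‖ ^ n := pow_pos (norm_pos_iff.2 hh0) n
        nlinarith [norm_nonneg (fderiv ℝ g h)]
      rw [abs_of_nonneg this]
  rcases hC0 with h1 | h1
  · rw [h0, sub_zero, sub_zero, h1] at key
    rw [Real.norm_of_nonneg (by positivity), pow_succ, ← mul_assoc]
    exact key
  · subst h1
    simp [h0]

theorem IsSmoothGerm.taylor_zero {f : E → F} {p : E} (hf : IsSmoothGerm f p) :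
    (fun h => f (p + h) - f p) =O[𝓝 0] fun h => ‖h‖ := by
  have h2 := hf.differentiableAt.isBigO_sub.comp_tendsto (tendsto_add_nhds_zero p)
  simpa [Function.comp_def] using h2.norm_right

theorem IsSmoothGerm.taylor_one {f : E → F} {p : E} (hf : IsSmoothGerm f p) :
    (fun h => f (p + h) - f p - fderiv ℝ f p h) =O[𝓝 0] fun h => ‖h‖ ^ 2 := by
  have hd : ∀ᶠ h in 𝓝 (0 : E), HasFDerivAt (fun h => f (p + h) - f p - fderiv ℝ f p h)
      (fderiv ℝ f (p + h) - fderiv ℝ f p) h := by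
    filter_upwards [eventually_nhds_zero_add hf] with h hh
    have h1 : HasFDerivAt f (fderiv ℝ f (p + h)) (p + h) :=
      (hh.differentiableAt (by simp)).hasFDerivAt
    exact (((hasFDerivAt_comp_add_left p).2 h1).sub_const _).sub (fderiv ℝ f p).hasFDerivAt
  refine isBigO_norm_pow_succ_of_fderiv (hd.mono fun h hh => hh.differentiableAt) (by simp) ?_
  refine (hf.fderiv.taylor_zero.congr' ?_ ?_)
  · filter_upwards [hd] with h hh using hh.fderiv.symm
  · simp

/-- By symmetry of the second derivative, `½ f''(h, h)` has derivative `f''(h, ·)`, so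
differentiating the remainder gives the first-order remainder of `fderiv ℝ f`. -/
theorem IsSmoothGerm.taylor_two {f : E → F} {p : E} (hf : IsSmoothGerm f p) :
    (fun h => f (p + h) - f p - fderiv ℝ f p h - (1 / 2 : ℝ) • fderiv ℝ (fderiv ℝ f) p h h)
      =O[𝓝 0] fun h => ‖h‖ ^ 3 := by
  have hsymm : IsSymmSndFDerivAt ℝ f p :=
    hf.contDiffAt.isSymmSndFDerivAt (by simpa using ENat.LEInfty.out)
  have hd : ∀ᶠ h in 𝓝 (0 : E), HasFDerivAt
      (fun h => f (p + h) - f p - fderiv ℝ f p h - (1 / 2 : ℝ) • fderiv ℝ (fderiv ℝ f) p h h)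
      (fderiv ℝ f (p + h) - fderiv ℝ f p - fderiv ℝ (fderiv ℝ f) p h) h := by
    filter_upwards [eventually_nhds_zero_add hf] with h hh
    have h1 : HasFDerivAt f (fderiv ℝ f (p + h)) (p + h) :=
      (hh.differentiableAt (by simp)).hasFDerivAt
    have h2 := ((fderiv ℝ (fderiv ℝ f) p).hasFDerivAt (x := h)).clm_apply (hasFDerivAt_id h)
    have h3 := ((((hasFDerivAt_comp_add_left p).2 h1).sub_const (f p)).sub (fderiv ℝ f p).hasFDerivAt).sub
      (h2.const_smul (1 / 2 : ℝ))
    refine h3.congr_fderiv ?_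
    ext v
    simp only [sub_apply, smul_apply,
      add_apply, ContinuousLinearMap.comp_apply,
      ContinuousLinearMap.flip_apply, ContinuousLinearMap.id_apply, id, hsymm v h]
    module
  refine isBigO_norm_pow_succ_of_fderiv (hd.mono fun h hh => hh.differentiableAt) (by simp) ?_
  refine (hf.fderiv.taylor_one.congr' ?_ ?_)
  · filter_upwards [hd] with h hh using hh.fderiv.symm
  · simp

/-! ### The inverse function theorem for germs -/

theorem IsSmoothGerm.exists_local_inverse [FiniteDimensional ℝ E] {f : E → E} {p : E}
    (hf : IsSmoothGerm f p) (hinj : Function.Injective (fderiv ℝ f p)) :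
    ∃ φ : E → E, IsSmoothGerm φ (f p) ∧ φ (f p) = p ∧ (∀ᶠ q in 𝓝 p, φ (f q) = q) ∧
      ∀ᶠ y in 𝓝 (f p), f (φ y) = y := by
  have : CompleteSpace E := FiniteDimensional.complete ℝ E
  let e : E ≃L[ℝ] E :=
    (LinearEquiv.ofInjectiveEndo (fderiv ℝ f p : E →ₗ[ℝ] E) hinj).toContinuousLinearEquiv
  have he : (e : E →L[ℝ] E) = fderiv ℝ f p := by
    ext v; rfl
  have hd : HasFDerivAt f (e : E →L[ℝ] E) p := he ▸ hf.differentiableAt.hasFDerivAt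
  let Φ := hf.contDiffAt.toOpenPartialHomeomorph f hd (by simp)
  have hΦ : (Φ : E → E) = f := hf.contDiffAt.toOpenPartialHomeomorph_coe hd (by simp)
  have hp : p ∈ Φ.source := hf.contDiffAt.mem_toOpenPartialHomeomorph_source hd (by simp)
  have hfp : f p ∈ Φ.target := by
    have := Φ.map_source hp
    rwa [hΦ] at this
  have hsp : Φ.symm (f p) = p := by
    have := Φ.left_inv hp
    rwa [hΦ] at this
  have hcont : ContinuousAt Φ.symm (f p) := Φ.continuousAt_symm hfp
  refine ⟨Φ.symm, ?_, hsp, ?_, ?_⟩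
  -- Smoothness of the inverse is needed on a neighbourhood, hence invertibility of the derivative
  -- at nearby points: the invertible operators form an open set.
  · have hinv : ∀ᶠ q in 𝓝 p, ∃ e' : E ≃L[ℝ] E, (e' : E →L[ℝ] E) = fderiv ℝ f q := by
      have := hf.fderiv.continuousAt.eventually (he ▸ e.nhds)
      exact this
    have h1 := hcont.eventually (p := fun q => ContDiffAt ℝ ∞ f q ∧
      ∃ e' : E ≃L[ℝ] E, (e' : E →L[ℝ] E) = fderiv ℝ f q) (by rw [hsp]; exact hf.and hinv)
    filter_upwards [h1, Φ.open_target.mem_nhds hfp] with y hy hyt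
    obtain ⟨hy1, e', he'⟩ := hy
    refine Φ.contDiffAt_symm hyt (f₀' := e') ?_ ?_
    · rw [hΦ, he']
      exact (hy1.differentiableAt (by simp)).hasFDerivAt
    · rw [hΦ]; exact hy1
  · filter_upwards [Φ.open_source.mem_nhds hp] with q hq
    have := Φ.left_inv hq
    rwa [hΦ] at this
  · filter_upwards [Φ.open_target.mem_nhds hfp] with y hy
    have := Φ.right_inv hy
    rwa [hΦ] at this

end Germs

/-! ### Hadamard's lemma -/

/-- Induction by differentiating under the integral sign. The target `F` is quantified inside the
induction because the derivative takes values in `E →L[ℝ] F`. -/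
theorem contDiff_nat_parametric_intervalIntegral {E : Type} [NormedAddCommGroup E]
    [NormedSpace ℝ E] [FiniteDimensional ℝ E] (n : ℕ) :
    ∀ {F : Type} [NormedAddCommGroup F] [NormedSpace ℝ F] [CompleteSpace F] {G : E × ℝ → F},
      ContDiff ℝ n G → ContDiff ℝ n fun x => ∫ θ in (0 : ℝ)..1, G (x, θ) := by
  have : ProperSpace E := FiniteDimensional.proper ℝ E
  induction n with
  | zero =>
    intro F _ _ _ G hG
    simp only [Nat.cast_zero, contDiff_zero] at hG ⊢
    exact intervalIntegral.continuous_parametric_intervalIntegral_of_continuous'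
      (f := fun x θ => G (x, θ)) hG 0 1
  | succ n ih =>
    intro F _ _ _ G hG
    rw [Nat.cast_succ] at hG ⊢
    let G' : E × ℝ → E →L[ℝ] F := fun q => (fderiv ℝ G q).comp (ContinuousLinearMap.inl ℝ E ℝ)
    have hG' : ContDiff ℝ n G' := (hG.fderiv_right le_rfl).clm_comp contDiff_const
    have hd : ∀ x θ, HasFDerivAt (fun x => G (x, θ)) (G' (x, θ)) x := fun x θ =>
      ((hG.differentiable (by simp) (x, θ)).hasFDerivAt).comp x (hasFDerivAt_prodMk_left x θ)
    refine contDiff_succ_iff_hasFDerivAt.2 ⟨fun x => ∫ θ in (0 : ℝ)..1, G' (x, θ), ih hG', ?_⟩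
    intro x
    have hcG := hG.continuous
    have hcG' := hG'.continuous
    obtain ⟨C, hC⟩ := ((isCompact_closedBall x (1 : ℝ)).prod (isCompact_uIcc (a := (0 : ℝ))
      (b := 1))).exists_bound_of_continuousOn hcG'.continuousOn
    refine intervalIntegral.hasFDerivAt_integral_of_dominated_of_fderiv_le
      (F := fun x θ => G (x, θ)) (F' := fun x θ => G' (x, θ)) (bound := fun _ => C)
      (Metric.closedBall_mem_nhds x one_pos) ?_ ?_ ?_ ?_ ?_ ?_
    · exact Eventually.of_forall fun y => (by fun_prop : Continuous fun θ => G (y, θ))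
        |>.aestronglyMeasurable
    · exact (by fun_prop : Continuous fun θ => G (x, θ)).intervalIntegrable _ _
    · exact (by fun_prop : Continuous fun θ => G' (x, θ)).aestronglyMeasurable
    · exact Eventually.of_forall fun θ hθ y hy => hC (y, θ) ⟨hy, Set.uIoc_subset_uIcc hθ⟩
    · exact intervalIntegrable_const
    · exact Eventually.of_forall fun θ _ y _ => hd y θ

theorem ContDiff.parametric_intervalIntegral {E F : Type} [NormedAddCommGroup E]
    [NormedSpace ℝ E] [FiniteDimensional ℝ E] [NormedAddCommGroup F] [NormedSpace ℝ F]
    [CompleteSpace F] {G : E × ℝ → F} (hG : ContDiff ℝ ∞ G) :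
    ContDiff ℝ ∞ fun x => ∫ θ in (0 : ℝ)..1, G (x, θ) :=
  contDiff_infty.2 fun n => contDiff_nat_parametric_intervalIntegral n (contDiff_infty.1 hG n)

/-- Multiplication by a bump function. A globally smooth representative lets the integral in
Hadamard's lemma be treated without tracking domains. -/
theorem IsSmoothGerm.exists_contDiff {E : Type*} [NormedAddCommGroup E] [NormedSpace ℝ E]
    [FiniteDimensional ℝ E] {f : E → ℝ} {p : E} (hf : IsSmoothGerm f p) :
    ∃ g : E → ℝ, ContDiff ℝ ∞ g ∧ g =ᶠ[𝓝 p] f := by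
  obtain ⟨ε, hε, H⟩ := Metric.eventually_nhds_iff_ball.1 hf
  let χ : ContDiffBump p := ⟨ε / 3, ε / 2, by positivity, by linarith⟩
  refine ⟨fun x => χ x * f x, ?_, ?_⟩
  · rw [contDiff_iff_contDiffAt]
    intro x
    by_cases hx : x ∈ Metric.ball p ε
    · exact χ.contDiff.contDiffAt.mul (H x hx)
    · have hx' : x ∉ tsupport χ := by
        rw [χ.tsupport_eq]
        intro h
        refine hx (Metric.closedBall_subset_ball ?_ h)
        change ε / 2 < ε
        linarith
      have h0 : (fun x => χ x * f x) =ᶠ[𝓝 x] fun _ => 0 := by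
        filter_upwards [notMem_tsupport_iff_eventuallyEq.1 hx'] with y hy
        simp [hy]
      exact contDiffAt_const.congr_of_eventuallyEq h0
  · filter_upwards [χ.eventuallyEq_one] with x hx
    simp [hx]

/-- Hadamard's lemma in the second variable. -/
theorem IsSmoothGerm.hadamard_snd {f : ℝ × ℝ → ℝ} (hf : IsSmoothGerm f 0) :
    ∃ g : ℝ × ℝ → ℝ, IsSmoothGerm g 0 ∧ ∀ᶠ q in 𝓝 (0 : ℝ × ℝ), f q = f (q.1, 0) + q.2 * g q := by
  obtain ⟨F, hF, hFf⟩ := hf.exists_contDiff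
  -- Integrand of `f(x, y) - f(x, 0) = y ∫₀¹ f_y(x, θ y) dθ`.
  let G : (ℝ × ℝ) × ℝ → ℝ := fun z => fderiv ℝ F (z.1.1, z.2 * z.1.2) (0, 1)
  have hG : ContDiff ℝ ∞ G := by
    have h1 : ContDiff ℝ ∞ fun z : (ℝ × ℝ) × ℝ => fderiv ℝ F (z.1.1, z.2 * z.1.2) :=
      (hF.fderiv_right (m := ∞) (by simp)).comp (by fun_prop)
    exact h1.clm_apply contDiff_const
  refine ⟨fun q => ∫ θ in (0 : ℝ)..1, G (q, θ), hG.parametric_intervalIntegral.isSmoothGerm 0, ?_⟩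
  have hc : Tendsto (fun q : ℝ × ℝ => (q.1, (0 : ℝ))) (𝓝 0) (𝓝 0) := by
    have : ContinuousAt (fun q : ℝ × ℝ => (q.1, (0 : ℝ))) 0 := by fun_prop
    exact this
  filter_upwards [hFf, hc.eventually hFf] with q h1 h2
  rw [← h1, ← h2, ← intervalIntegral.integral_const_mul]
  have hd : ∀ θ : ℝ, HasDerivAt (fun θ : ℝ => F (q.1, θ * q.2)) (q.2 * G (q, θ)) θ := by
    intro θ
    have h3 : HasDerivAt (fun θ : ℝ => (q.1, θ * q.2)) (0, q.2) θ := by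
      simpa using (hasDerivAt_const θ q.1).prodMk ((hasDerivAt_id θ).mul_const q.2)
    have h4 := ((hF.differentiable (by simp)
      (q.1, θ * q.2)).hasFDerivAt).comp_hasDerivAt θ h3
    rw [show ((0 : ℝ), q.2) = q.2 • ((0 : ℝ), (1 : ℝ)) by simp, map_smul] at h4
    exact h4
  have hcG : Continuous fun θ : ℝ => q.2 * G (q, θ) := by
    have := hG.continuous
    fun_prop
  rw [intervalIntegral.integral_eq_sub_of_hasDerivAt (fun θ _ => hd θ)
    (hcG.intervalIntegrable _ _)]
  simp

/-- Hadamard's lemma in one variable. -/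
theorem IsSmoothGerm.hadamard {f : ℝ → ℝ} (hf : IsSmoothGerm f 0) :
    ∃ g : ℝ → ℝ, IsSmoothGerm g 0 ∧ ∀ᶠ x in 𝓝 (0 : ℝ), f x = f 0 + x * g x := by
  obtain ⟨g, hg, h⟩ := (IsSmoothGerm.comp' hf (IsSmoothGerm.snd (IsSmoothGerm.id (0 : ℝ × ℝ)))
    rfl).hadamard_snd
  refine ⟨fun x => g (0, x), hg.comp' (f := fun x : ℝ => ((0 : ℝ), x))
    (IsSmoothGerm.prodMk (.const _ _) (.id _)) rfl, ?_⟩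
  have hc : Tendsto (fun x : ℝ => ((0 : ℝ), x)) (𝓝 0) (𝓝 0) := by
    have : ContinuousAt (fun x : ℝ => ((0 : ℝ), x)) 0 := by fun_prop
    exact this
  simpa using hc.eventually h


/-! ### Orders of vanishing -/

section Order

variable {E : Type*} [NormedAddCommGroup E]

theorem Asymptotics.IsBigO.norm_pow_mono {F : Type*} [NormedAddCommGroup F] {f : E → F} {m n : ℕ}
    (h : f =O[𝓝 0] fun x => ‖x‖ ^ n) (hmn : m ≤ n) : f =O[𝓝 0] fun x => ‖x‖ ^ m := by
  refine h.trans (IsBigO.of_bound 1 ?_)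
  filter_upwards [Metric.ball_mem_nhds (0 : E) one_pos] with x hx
  have hx1 : ‖x‖ ≤ 1 := by simpa using (mem_ball_zero_iff.1 hx).le
  simpa using pow_le_pow_of_le_one (norm_nonneg x) hx1 hmn

theorem Asymptotics.IsBigO.norm_pow_mul {f g : E → ℝ} {m n : ℕ}
    (hf : f =O[𝓝 0] fun x => ‖x‖ ^ m) (hg : g =O[𝓝 0] fun x => ‖x‖ ^ n) :
    (fun x => f x * g x) =O[𝓝 0] fun x => ‖x‖ ^ (m + n) := by
  simpa only [pow_add] using hf.mul hg

/-- Allows the components of `φ - p` to be replaced by their linear parts inside quadratic terms, at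
the cost of a third-order error. -/
theorem isBigO_mul_sub_mul {f f₀ g g₀ : E → ℝ}
    (hf : (fun x => f x - f₀ x) =O[𝓝 0] fun x => ‖x‖ ^ 2)
    (hg : (fun x => g x - g₀ x) =O[𝓝 0] fun x => ‖x‖ ^ 2)
    (hf₀ : f₀ =O[𝓝 0] fun x => ‖x‖ ^ 1) (hg₀ : g₀ =O[𝓝 0] fun x => ‖x‖ ^ 1) :
    (fun x => f x * g x - f₀ x * g₀ x) =O[𝓝 0] fun x => ‖x‖ ^ 3 := by
  have h := ((hf.norm_pow_mul hg).norm_pow_mono (m := 3) (by norm_num)).add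
    ((hf.norm_pow_mul hg₀).add (hf₀.norm_pow_mul hg))
  refine h.congr_left fun x => ?_
  ring

/-- Along the ray `r • v` the hypothesis reads `r ^ n * P v = O(r ^ (n + 1))`. This is what makes
comparison of coefficients possible. -/
theorem eq_zero_of_homogeneous_of_isBigO [NormedSpace ℝ E] {P : E → ℝ} {n : ℕ}
    (hP : ∀ (r : ℝ) v, P (r • v) = r ^ n * P v) (hO : P =O[𝓝 0] fun x => ‖x‖ ^ (n + 1)) (v : E) :
    P v = 0 := by
  by_contra hv
  have hc : Tendsto (fun r : ℝ => r • v) (𝓝 0) (𝓝 0) := by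
    have : ContinuousAt (fun r : ℝ => r • v) 0 := by fun_prop
    simpa [ContinuousAt] using this
  have h1 := hO.comp_tendsto hc
  have h2 : (fun r : ℝ => r ^ n) =O[𝓝 0] fun r : ℝ => r ^ (n + 1) := by
    refine (IsBigO.of_bound (‖P v‖⁻¹) ?_).trans (h1.trans (IsBigO.of_bound (‖v‖ ^ (n + 1)) ?_))
    · refine Eventually.of_forall fun r => ?_
      simp only [Function.comp_apply, hP, norm_mul]
      have : ‖P v‖ ≠ 0 := by simpa using hv
      field_simp
      exact le_rfl
    · refine Eventually.of_forall fun r => ?_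
      simp only [Function.comp_apply, norm_smul, norm_pow, norm_norm, norm_mul, mul_pow]
      rw [mul_comm]
  have h3 : (fun r : ℝ => r ^ (n + 1)) =o[𝓝 0] fun r : ℝ => r ^ n :=
    isLittleO_pow_pow (Nat.lt_succ_self n)
  have h4 := h2.trans_isLittleO h3
  refine isLittleO_irrefl ?_ h4
  have : ∃ᶠ r in 𝓝[≠] (0 : ℝ), r ^ n ≠ 0 := by
    refine Eventually.frequently ?_
    filter_upwards [self_mem_nhdsWithin] with r hr using pow_ne_zero n hr
  exact this.filter_mono nhdsWithin_le_nhds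

theorem hasFDerivAt_of_isBigO_sq [NormedSpace ℝ E] {F : Type*} [NormedAddCommGroup F]
    [NormedSpace ℝ F] {f : E → F} {A : E →L[ℝ] F} {p : E}
    (h : (fun h => f (p + h) - f p - A h) =O[𝓝 0] fun h => ‖h‖ ^ 2) : HasFDerivAt f A p := by
  rw [hasFDerivAt_iff_isLittleO_nhds_zero]
  exact h.trans_isLittleO (isLittleO_norm_pow_id one_lt_two)

end Order

theorem isBigO_fst : (fun x : ℝ × ℝ => x.1) =O[𝓝 0] fun x => ‖x‖ ^ 1 :=
  IsBigO.of_bound 1 (Eventually.of_forall fun x => by simpa using norm_fst_le x)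

theorem isBigO_snd : (fun x : ℝ × ℝ => x.2) =O[𝓝 0] fun x => ‖x‖ ^ 1 :=
  IsBigO.of_bound 1 (Eventually.of_forall fun x => by simpa using norm_snd_le x)

theorem isBigO_linear (a b : ℝ) :
    (fun x : ℝ × ℝ => a * x.1 + b * x.2) =O[𝓝 0] fun x => ‖x‖ ^ 1 :=
  (isBigO_fst.const_mul_left a).add (isBigO_snd.const_mul_left b)

theorem linear_coeff_eq_zero {a b : ℝ}
    (h : (fun x : ℝ × ℝ => a * x.1 + b * x.2) =O[𝓝 0] fun x => ‖x‖ ^ 2) : a = 0 ∧ b = 0 := by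
  have H := eq_zero_of_homogeneous_of_isBigO (n := 1) (fun r v => by simp; ring) h
  have h1 := H (1, 0)
  have h2 := H (0, 1)
  simp at h1 h2
  exact ⟨h1, h2⟩

theorem quadratic_coeff_eq_zero {a b c : ℝ}
    (h : (fun x : ℝ × ℝ => a * x.1 ^ 2 + b * (x.1 * x.2) + c * x.2 ^ 2)
      =O[𝓝 0] fun x => ‖x‖ ^ 3) : a = 0 ∧ b = 0 ∧ c = 0 := by
  have H := eq_zero_of_homogeneous_of_isBigO (n := 2) (fun r v => by simp; ring) h
  have h1 := H (1, 0)
  have h2 := H (0, 1)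
  have h3 := H (1, 1)
  simp at h1 h2 h3
  refine ⟨h1, ?_, h2⟩
  linarith

/-! ### Normalization of a cross-cap by a rotation -/

/-- The map `f` has at `p` the 2-jet
`(u, g₁ u + g₂ u² / 2 + v², h₁ u + h₂ u² / 2 + m u v + k v²)`. -/
def HasUmbrellaJet (f : ℝ × ℝ → Fin 3 → ℝ) (p : ℝ × ℝ) (g1 g2 h1 h2 m k : ℝ) : Prop :=
  (fun h : ℝ × ℝ => f (p + h) - f p - ![h.1, g1 * h.1 + g2 / 2 * h.1 ^ 2 + h.2 ^ 2,
    h1 * h.1 + h2 / 2 * h.1 ^ 2 + m * (h.1 * h.2) + k * h.2 ^ 2]) =O[𝓝 0] fun h => ‖h‖ ^ 3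

section BruceWest

variable {f : ℝ × ℝ → Fin 3 → ℝ} {p : ℝ × ℝ} {g1 g2 h1 h2 m k : ℝ}

theorem HasUmbrellaJet.mulVec (hf : HasUmbrellaJet f p g1 g2 h1 h2 m k)
    (T : Matrix (Fin 3) (Fin 3) ℝ) (i : Fin 3) :
    (fun h : ℝ × ℝ => (T *ᵥ (f (p + h) - f p)) i -
      ((T i 0 + T i 1 * g1 + T i 2 * h1) * h.1 + (T i 1 * g2 + T i 2 * h2) / 2 * (h.1 * h.1)
        + T i 2 * m * (h.1 * h.2) + (T i 1 + T i 2 * k) * (h.2 * h.2)))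
      =O[𝓝 0] fun h => ‖h‖ ^ 3 := by
  have H := isBigO_pi.1 hf
  have := ((H 0).const_mul_left (T i 0)).add
    (((H 1).const_mul_left (T i 1)).add ((H 2).const_mul_left (T i 2)))
  refine this.congr_left fun h => ?_
  simp [Matrix.mulVec, dotProduct, Fin.sum_univ_three]
  ring

theorem isBigO_sub_linear_of_isSmoothGerm {φ : ℝ × ℝ → ℝ} (hφ : IsSmoothGerm φ 0) :
    (fun x : ℝ × ℝ => φ x - φ 0 - (fderiv ℝ φ 0 (1, 0) * x.1 + fderiv ℝ φ 0 (0, 1) * x.2))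
      =O[𝓝 0] fun x => ‖x‖ ^ 2 := by
  refine hφ.taylor_one.congr_left fun x => ?_
  have : fderiv ℝ φ 0 x = fderiv ℝ φ 0 (1, 0) * x.1 + fderiv ℝ φ 0 (0, 1) * x.2 := by
    conv_lhs => rw [show x = x.1 • ((1 : ℝ), (0 : ℝ)) + x.2 • ((0 : ℝ), (1 : ℝ)) by
      ext <;> simp]
    rw [map_add, map_smul, map_smul, smul_eq_mul, smul_eq_mul]
    ring
  rw [this, zero_add]

/-- The rows of a rotated umbrella in a new coordinate system. -/
theorem HasUmbrellaJet.mulVec_comp (hf : HasUmbrellaJet f p g1 g2 h1 h2 m k)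
    (T : Matrix (Fin 3) (Fin 3) ℝ) (i : Fin 3) {φ : ℝ × ℝ → ℝ × ℝ} (hφ : ContinuousAt φ 0)
    (hφ0 : φ 0 = p) {a a' b c : ℝ}
    (h1st : (fun x : ℝ × ℝ => (φ x).1 - p.1 - (a * x.1 + a' * x.2)) =O[𝓝 0] fun x => ‖x‖ ^ 2)
    (h2nd : (fun x : ℝ × ℝ => (φ x).2 - p.2 - (b * x.1 + c * x.2)) =O[𝓝 0] fun x => ‖x‖ ^ 2) :
    (fun x : ℝ × ℝ => (T *ᵥ (f (φ x) - f p)) i -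
      ((T i 0 + T i 1 * g1 + T i 2 * h1) * ((φ x).1 - p.1)
        + (T i 1 * g2 + T i 2 * h2) / 2 * ((a * x.1 + a' * x.2) * (a * x.1 + a' * x.2))
        + T i 2 * m * ((a * x.1 + a' * x.2) * (b * x.1 + c * x.2))
        + (T i 1 + T i 2 * k) * ((b * x.1 + c * x.2) * (b * x.1 + c * x.2))))
      =O[𝓝 0] fun x => ‖x‖ ^ 3 := by
  have ht : Tendsto (fun x => φ x - p) (𝓝 0) (𝓝 0) := by
    have : ContinuousAt (fun x => φ x - p) 0 := hφ.sub continuousAt_const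
    simpa [ContinuousAt, hφ0] using this
  have hO1 : (fun x => (φ x).1 - p.1) =O[𝓝 0] fun x => ‖x‖ ^ 1 :=
    ((h1st.norm_pow_mono one_le_two).add (isBigO_linear a a')).congr_left fun x => by ring
  have hO2 : (fun x => (φ x).2 - p.2) =O[𝓝 0] fun x => ‖x‖ ^ 1 :=
    ((h2nd.norm_pow_mono one_le_two).add (isBigO_linear b c)).congr_left fun x => by ring
  have hO : (fun x => φ x - p) =O[𝓝 0] fun x => ‖x‖ ^ 1 :=
    (hO1.prod_left hO2 :)
  have hO3 : (fun x => ‖φ x - p‖ ^ 3) =O[𝓝 0] fun x => ‖x‖ ^ 3 := by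
    simpa using hO.norm_left.pow 3
  have A := ((hf.mulVec T i).comp_tendsto ht).trans hO3
  -- Only the quadratic terms are linearized. The linear term keeps `(φ x).1 - p.1`, whose
  -- second-order part is unknown; it disappears for the rows in which its coefficient is zero.
  have q11 := isBigO_mul_sub_mul h1st h1st (isBigO_linear a a') (isBigO_linear a a')
  have q12 := isBigO_mul_sub_mul h1st h2nd (isBigO_linear a a') (isBigO_linear b c)
  have q22 := isBigO_mul_sub_mul h2nd h2nd (isBigO_linear b c) (isBigO_linear b c)
  have := A.add (((q11.const_mul_left ((T i 1 * g2 + T i 2 * h2) / 2)).add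
    (q12.const_mul_left (T i 2 * m))).add (q22.const_mul_left (T i 1 + T i 2 * k)))
  refine this.congr_left fun x => ?_
  simp only [Function.comp_apply, add_sub_cancel, Prod.fst_sub, Prod.snd_sub]
  ring

end BruceWest

section Rotation

variable {T : Matrix (Fin 3) (Fin 3) ℝ}

theorem specialOrthogonalGroup_row_dotProduct (hT : T ∈ Matrix.specialOrthogonalGroup (Fin 3) ℝ)
    (i j : Fin 3) : T i 0 * T j 0 + T i 1 * T j 1 + T i 2 * T j 2 = if i = j then 1 else 0 := by
  have h := (Matrix.mem_orthogonalGroup_iff (Fin 3) ℝ).1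
    (Matrix.mem_specialOrthogonalGroup_iff.1 hT).1
  have := congrFun (congrFun h i) j
  simpa [Matrix.mul_apply, Fin.sum_univ_three, Matrix.one_apply] using this

theorem specialOrthogonalGroup_col_dotProduct (hT : T ∈ Matrix.specialOrthogonalGroup (Fin 3) ℝ)
    (i j : Fin 3) : T 0 i * T 0 j + T 1 i * T 1 j + T 2 i * T 2 j = if i = j then 1 else 0 := by
  have h := (Matrix.mem_orthogonalGroup_iff' (Fin 3) ℝ).1
    (Matrix.mem_specialOrthogonalGroup_iff.1 hT).1
  have := congrFun (congrFun h i) j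
  simpa [Matrix.mul_apply, Fin.sum_univ_three, Matrix.one_apply] using this

/-- The last row of a rotation is the cross product of the first two. -/
theorem specialOrthogonalGroup_last_row (hT : T ∈ Matrix.specialOrthogonalGroup (Fin 3) ℝ) :
    T 2 0 = T 0 1 * T 1 2 - T 0 2 * T 1 1 ∧ T 2 1 = T 0 2 * T 1 0 - T 0 0 * T 1 2 ∧
      T 2 2 = T 0 0 * T 1 1 - T 0 1 * T 1 0 := by
  have h00 := specialOrthogonalGroup_row_dotProduct hT 0 0
  have h01 := specialOrthogonalGroup_row_dotProduct hT 0 1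
  have h11 := specialOrthogonalGroup_row_dotProduct hT 1 1
  have h22 := specialOrthogonalGroup_row_dotProduct hT 2 2
  have hdet := (Matrix.mem_specialOrthogonalGroup_iff.1 hT).2
  rw [Matrix.det_fin_three] at hdet
  simp only [if_true, Fin.isValue, zero_ne_one, if_false] at h00 h01 h11 h22
  -- The squared distance from the third row to `r₀ × r₁` is `1 + |r₀ × r₁|² - 2 det T`, which
  -- vanishes by Lagrange's identity.
  have key : (T 2 0 - (T 0 1 * T 1 2 - T 0 2 * T 1 1)) ^ 2
      + (T 2 1 - (T 0 2 * T 1 0 - T 0 0 * T 1 2)) ^ 2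
      + (T 2 2 - (T 0 0 * T 1 1 - T 0 1 * T 1 0)) ^ 2 = 0 := by
    linear_combination h22 + (T 1 0 * T 1 0 + T 1 1 * T 1 1 + T 1 2 * T 1 2) * h00 + h11
      - (T 0 0 * T 1 0 + T 0 1 * T 1 1 + T 0 2 * T 1 2) * h01 - 2 * hdet
  have hz : ∀ {a b c : ℝ}, a ^ 2 + b ^ 2 + c ^ 2 = 0 → a = 0 := fun {a b c} h =>
    pow_eq_zero_iff two_ne_zero |>.1 (by linarith [sq_nonneg a, sq_nonneg b, sq_nonneg c])
  refine ⟨sub_eq_zero.1 (hz key), ?_, ?_⟩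
  · rw [add_comm (_ ^ 2) (_ ^ 2)] at key
    exact sub_eq_zero.1 (hz key)
  · rw [add_comm, ← add_assoc] at key
    exact sub_eq_zero.1 (hz key)

end Rotation

/-- The rotation that takes `(1, g₁, h₁)` to the first axis and `(0, 1, k)` to the half plane
spanned by the first axis and the positive third axis. -/
def umbrellaRotation (E D g1 h1 k : ℝ) : Matrix (Fin 3) (Fin 3) ℝ :=
  !![1 / E, g1 / E, h1 / E;
     (h1 - k * g1) / D, k / D, -1 / D;
     (-g1 - h1 * k) / (E * D), (h1 * (h1 - k * g1) + 1) / (E * D),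
       (k - g1 * (h1 - k * g1)) / (E * D)]

theorem umbrellaRotation_mem {E D g1 h1 k : ℝ} (hE : 0 < E) (hD : 0 < D)
    (hE2 : E ^ 2 = 1 + g1 ^ 2 + h1 ^ 2) (hD2 : D ^ 2 = 1 + k ^ 2 + (g1 * k - h1) ^ 2) :
    umbrellaRotation E D g1 h1 k ∈ Matrix.specialOrthogonalGroup (Fin 3) ℝ := by
  have hED : (E * D) ^ 2 = (-g1 - h1 * k) ^ 2 + (h1 * (h1 - k * g1) + 1) ^ 2
      + (k - g1 * (h1 - k * g1)) ^ 2 := by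
    rw [mul_pow, hE2, hD2]; ring
  rw [Matrix.mem_specialOrthogonalGroup_iff, Matrix.mem_orthogonalGroup_iff]
  constructor
  · ext i j
    fin_cases i <;> fin_cases j <;>
      simp [umbrellaRotation, Matrix.mul_apply, Fin.sum_univ_three] <;> field_simp <;>
      first
        | ring1
        | linear_combination -hE2
        | linear_combination -hD2
        | linear_combination -hED
  · rw [Matrix.det_fin_three]
    simp [umbrellaRotation]
    field_simp
    linear_combination -hE2 * D ^ 2 - hD2 * (1 + g1 ^ 2 + h1 ^ 2)

/-- The rotation in a normalization of an umbrella is unique. -/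
theorem eq_umbrellaRotation {T : Matrix (Fin 3) (Fin 3) ℝ} {E D g1 h1 k : ℝ}
    (hT : T ∈ Matrix.specialOrthogonalGroup (Fin 3) ℝ) (hE : 0 < E) (hD : 0 < D)
    (hE2 : E ^ 2 = 1 + g1 ^ 2 + h1 ^ 2) (hD2 : D ^ 2 = 1 + k ^ 2 + (g1 * k - h1) ^ 2)
    (h0 : 0 < T 0 0 + T 0 1 * g1 + T 0 2 * h1) (h1' : T 1 0 + T 1 1 * g1 + T 1 2 * h1 = 0)
    (h2' : T 2 0 + T 2 1 * g1 + T 2 2 * h1 = 0) (h3 : T 1 1 + T 1 2 * k = 0)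
    (h4 : 0 < T 2 1 + T 2 2 * k) : T = umbrellaRotation E D g1 h1 k := by
  obtain ⟨w0, w1, w2⟩ := specialOrthogonalGroup_last_row hT
  have r0 := specialOrthogonalGroup_col_dotProduct hT
  have c00 := r0 0 0
  have c01 := r0 0 1
  have c02 := r0 0 2
  have c11 := r0 1 1
  have c12 := r0 1 2
  have c22 := r0 2 2
  have n1 := specialOrthogonalGroup_row_dotProduct hT 1 1
  have n0 := specialOrthogonalGroup_row_dotProduct hT 0 0
  simp only [if_true, Fin.isValue, zero_ne_one, if_false, Fin.reduceEq]
    at c00 c01 c02 c11 c12 c22 n1 n0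
  set ε := T 0 0 + T 0 1 * g1 + T 0 2 * h1 with hε
  -- `T` sends `w = (1, g1, h1)` to `ε e₀`, so `w = Tᵀ (ε e₀)` is `ε` times the first row; comparing
  -- lengths gives `ε = E`.
  have t0 : T 0 0 * ε = 1 := by
    linear_combination T 0 0 * hε + c00 + c01 * g1 + c02 * h1 - T 1 0 * h1' - T 2 0 * h2'
  have t1 : T 0 1 * ε = g1 := by
    linear_combination T 0 1 * hε + c01 + c11 * g1 + c12 * h1 - T 1 1 * h1' - T 2 1 * h2'
  have t2 : T 0 2 * ε = h1 := by
    linear_combination T 0 2 * hε + c02 + c12 * g1 + c22 * h1 - T 1 2 * h1' - T 2 2 * h2'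
  have hεE : ε = E := by
    have : ε ^ 2 = E ^ 2 := by
      rw [hE2]
      linear_combination -ε ^ 2 * n0 + (T 0 0 * ε + 1) * t0 + (T 0 1 * ε + g1) * t1
        + (T 0 2 * ε + h1) * t2
    exact (pow_left_inj₀ h0.le hE.le two_ne_zero).1 this
  rw [hεE] at t0 t1 t2
  -- The second row is orthogonal to `(1, g1, h1)` and `(0, 1, k)`, hence equals `T 1 2` times their
  -- cross product `(g1 k - h1, -k, 1)`, a vector of length `D`. The sign of `T 1 2` comes from
  -- `h4`.
  have s1 : T 1 1 = -k * T 1 2 := by linarith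
  have s0 : T 1 0 = (k * g1 - h1) * T 1 2 := by linear_combination h1' - g1 * s1
  have hs2 : (T 1 2 * D) ^ 2 = 1 := by
    rw [s1, s0] at n1
    rw [mul_pow, hD2]
    linear_combination n1
  have hneg : T 1 2 < 0 := by
    have : E * (T 2 1 + T 2 2 * k) = -T 1 2 * D ^ 2 := by
      rw [w1, w2, hD2, s1, s0]
      linear_combination (-T 1 2 - k ^ 2 * T 1 2) * t0 - k * (k * g1 - h1) * T 1 2 * t1
        + (k * g1 - h1) * T 1 2 * t2
    have h5 : 0 < -T 1 2 * D ^ 2 := this ▸ mul_pos hE h4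
    nlinarith [sq_nonneg D]
  have hs : T 1 2 = -1 / D := by
    have h6 : T 1 2 * D < 0 := mul_neg_of_neg_of_pos hneg hD
    rcases sq_eq_sq_iff_eq_or_eq_neg.1 (hs2.trans (one_pow 2).symm) with h | h
    · linarith
    · field_simp; linarith
  have q0 : T 0 0 = 1 / E := by field_simp; linarith
  have q1 : T 0 1 = g1 / E := by field_simp; linarith
  have q2 : T 0 2 = h1 / E := by field_simp; linarith
  rw [hs] at s1 s0
  simp only [q0, q1, q2, hs, s1, s0] at w0 w1 w2
  ext i j
  fin_cases i <;> fin_cases j <;> simp [umbrellaRotation, q0, q1, q2, s0, s1, hs, w0, w1, w2] <;>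
    field_simp <;> ring


/-! ### Uniqueness and existence of the invariants of a 2-jet -/

section BruceWest

variable {f : ℝ × ℝ → Fin 3 → ℝ} {p : ℝ × ℝ} {g1 g2 h1 h2 m k E D : ℝ}

/-- The quadratic coefficients of the last two components of the rotated umbrella. -/
theorem umbrellaRotation_coeff (hE : 0 < E) (hD : 0 < D)
    (hD2 : D ^ 2 = 1 + k ^ 2 + (g1 * k - h1) ^ 2) :
    let T := umbrellaRotation E D g1 h1 k
    (T 1 0 + T 1 1 * g1 + T 1 2 * h1 = 0 ∧ T 1 1 * g2 + T 1 2 * h2 = (k * g2 - h2) / D ∧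
      T 1 2 * m = -m / D ∧ T 1 1 + T 1 2 * k = 0) ∧
    T 2 0 + T 2 1 * g1 + T 2 2 * h1 = 0 ∧
      T 2 1 * g2 + T 2 2 * h2 =
        (g2 * (1 + h1 ^ 2 - k * g1 * h1) + h2 * (k - g1 * h1 + k * g1 ^ 2)) / (E * D) ∧
      T 2 2 * m = m * (k - g1 * h1 + k * g1 ^ 2) / (E * D) ∧ T 2 1 + T 2 2 * k = D / E := by
  refine ⟨⟨?_, ?_, ?_, ?_⟩, ?_, ?_, ?_, ?_⟩ <;> simp [umbrellaRotation] <;> field_simp <;>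
    first
      | ring1
      | linear_combination -hD2

/-- Comparison of coefficients up to order two first forces the rotation, then the linear part `(a,
0; b, c)` of `φ`, and finally the invariants. -/
theorem HasBruceWestInvariants.eq_of_hasUmbrellaJet (hf : HasUmbrellaJet f p g1 g2 h1 h2 m k)
    (hm : m ≠ 0) (hE : 0 < E) (hD : 0 < D)
    (hE2 : E ^ 2 = 1 + g1 ^ 2 + h1 ^ 2) (hD2 : D ^ 2 = 1 + k ^ 2 + (g1 * k - h1) ^ 2) {x y z : ℝ}
    (h : HasBruceWestInvariants f p x y z) :
    x = ((g2 * (1 + h1 ^ 2 - k * g1 * h1) + h2 * (k - g1 * h1 + k * g1 ^ 2)) / (E * D)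
        + (k * g2 - h2) * (k - g1 * h1 + k * g1 ^ 2) / (E * D)
        + (h2 - k * g2) ^ 2 * D / (2 * E * m ^ 2)) / E ^ 2 ∧
      y = -(k - g1 * h1 + k * g1 ^ 2) / E + (h2 - k * g2) * D ^ 2 / (E * m ^ 2) ∧
      z = 2 * E * D ^ 3 / m ^ 2 := by
  obtain ⟨hz, φ, hφ, hφ0, -, hpos, T, hT, r₂, r₃, hr₂, hr₃, heq⟩ := h
  have hT1 : ∀ᶠ q in 𝓝 (0 : ℝ × ℝ), (T *ᵥ (f (φ q) - f p)) 0 = q.1 :=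
    heq.mono fun q hq => by rw [hq]; rfl
  have hT2 : ∀ᶠ q in 𝓝 (0 : ℝ × ℝ), (T *ᵥ (f (φ q) - f p)) 1 = q.1 * q.2 + r₂ q :=
    heq.mono fun q hq => by rw [hq]; rfl
  have hT3 : ∀ᶠ q in 𝓝 (0 : ℝ × ℝ), (T *ᵥ (f (φ q) - f p)) 2 =
      (x * q.1 ^ 2 + 2 * y * (q.1 * q.2) + z * q.2 ^ 2) / 2 + r₃ q :=
    heq.mono fun q hq => by rw [hq]; rfl
  have hU := isBigO_sub_linear_of_isSmoothGerm hφ.fst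
  have hV := isBigO_sub_linear_of_isSmoothGerm hφ.snd
  have ha : fderiv ℝ (fun q => (φ q).1) 0 (1, 0) = (fderiv ℝ φ 0 (1, 0)).1 := by
    rw [fderiv.fst hφ.differentiableAt]; rfl
  rw [ha, hφ0] at hU
  rw [hφ0] at hV
  set a := (fderiv ℝ φ 0 (1, 0)).1
  set a' := fderiv ℝ (fun q => (φ q).1) 0 (0, 1)
  set b := fderiv ℝ (fun q => (φ q).2) 0 (1, 0)
  set c := fderiv ℝ (fun q => (φ q).2) 0 (0, 1)
  have hrow := fun i => hf.mulVec_comp T i hφ.continuousAt hφ0 hU hV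
  -- comparison of the linear terms
  have hlin : ∀ (i : Fin 3) (δ : ℝ),
      (fun q : ℝ × ℝ => (T *ᵥ (f (φ q) - f p)) i - δ * q.1) =O[𝓝 0] (fun q => ‖q‖ ^ 2) →
      (T i 0 + T i 1 * g1 + T i 2 * h1) * a = δ ∧
        (T i 0 + T i 1 * g1 + T i 2 * h1) * a' = 0 := by
    intro i δ hi
    have l11 := (isBigO_linear a a').norm_pow_mul (isBigO_linear a a')
    have l12 := (isBigO_linear a a').norm_pow_mul (isBigO_linear b c)
    have l22 := (isBigO_linear b c).norm_pow_mul (isBigO_linear b c)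
    have H := (hi.sub ((hrow i).norm_pow_mono (m := 2) (by norm_num))).sub
      (((hU.const_mul_left (T i 0 + T i 1 * g1 + T i 2 * h1)).add
        (l11.const_mul_left ((T i 1 * g2 + T i 2 * h2) / 2))).add
        ((l12.const_mul_left (T i 2 * m)).add (l22.const_mul_left (T i 1 + T i 2 * k))))
    have H2 : (fun q : ℝ × ℝ => ((T i 0 + T i 1 * g1 + T i 2 * h1) * a - δ) * q.1
        + (T i 0 + T i 1 * g1 + T i 2 * h1) * a' * q.2) =O[𝓝 0] fun q => ‖q‖ ^ 2 :=
      H.congr_left fun q => by ring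
    obtain ⟨h3, h4⟩ := linear_coeff_eq_zero H2
    exact ⟨by linarith, h4⟩
  have hq11 := isBigO_fst.norm_pow_mul isBigO_fst
  have hq12 := isBigO_fst.norm_pow_mul isBigO_snd
  have hq22 := isBigO_snd.norm_pow_mul isBigO_snd
  obtain ⟨e0, e0'⟩ := hlin 0 1 (by
    refine (isBigO_zero _ _).congr' ?_ EventuallyEq.rfl
    filter_upwards [hT1] with q hq
    simp [hq])
  obtain ⟨e1, -⟩ := hlin 1 0 (by
    refine (hq12.add (hr₂.2.norm_pow_mono (m := 2) (by norm_num))).congr' ?_ EventuallyEq.rfl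
    filter_upwards [hT2] with q hq
    simp [hq])
  obtain ⟨e2, -⟩ := hlin 2 0 (by
    refine ((((hq11.const_mul_left (x / 2)).add (hq12.const_mul_left y)).add
      (hq22.const_mul_left (z / 2))).add (hr₃.2.norm_pow_mono (m := 2) (by norm_num))).congr'
      ?_ EventuallyEq.rfl
    filter_upwards [hT3] with q hq
    simp only [hq]
    ring)
  have e0pos : 0 < T 0 0 + T 0 1 * g1 + T 0 2 * h1 := by
    by_contra hneg
    nlinarith
  have ha' : a' = 0 := (mul_eq_zero.1 e0').resolve_left e0pos.ne'
  have e1 := (mul_eq_zero.1 e1).resolve_right hpos.ne'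
  have e2 := (mul_eq_zero.1 e2).resolve_right hpos.ne'
  -- comparison of the quadratic terms
  have hquad : ∀ (i : Fin 3) (A B C : ℝ), T i 0 + T i 1 * g1 + T i 2 * h1 = 0 →
      (fun q : ℝ × ℝ => (T *ᵥ (f (φ q) - f p)) i -
        (A * q.1 ^ 2 + B * (q.1 * q.2) + C * q.2 ^ 2)) =O[𝓝 0] (fun q => ‖q‖ ^ 3) →
      A = (T i 1 * g2 + T i 2 * h2) / 2 * a ^ 2 + T i 2 * m * (a * b)
          + (T i 1 + T i 2 * k) * b ^ 2 ∧
        B = T i 2 * m * (a * c) + 2 * (T i 1 + T i 2 * k) * (b * c) ∧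
        C = (T i 1 + T i 2 * k) * c ^ 2 := by
    intro i A B C hi hq
    have H := hq.sub (hrow i)
    have H2 : (fun q : ℝ × ℝ =>
        ((T i 1 * g2 + T i 2 * h2) / 2 * a ^ 2 + T i 2 * m * (a * b)
          + (T i 1 + T i 2 * k) * b ^ 2 - A) * q.1 ^ 2
        + (T i 2 * m * (a * c) + 2 * (T i 1 + T i 2 * k) * (b * c) - B) * (q.1 * q.2)
        + ((T i 1 + T i 2 * k) * c ^ 2 - C) * q.2 ^ 2) =O[𝓝 0] fun q => ‖q‖ ^ 3 :=
      H.congr_left fun q => by rw [hi, ha']; ring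
    obtain ⟨h3, h4, h5⟩ := quadratic_coeff_eq_zero H2
    exact ⟨by linarith, by linarith, by linarith⟩
  obtain ⟨A1, B1, C1⟩ := hquad 1 0 1 0 e1 (by
    refine hr₂.2.congr' ?_ EventuallyEq.rfl
    filter_upwards [hT2] with q hq
    simp [hq])
  obtain ⟨A2, B2, C2⟩ := hquad 2 (x / 2) y (z / 2) e2 (by
    refine hr₃.2.congr' ?_ EventuallyEq.rfl
    filter_upwards [hT3] with q hq
    simp only [hq]
    ring)
  -- The coefficient `1` of `xy` in the second component excludes `c = 0`. The absence of `y²` there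
  -- and `0 < z` then give the last two conditions that single out the rotation.
  have hc : c ≠ 0 := by
    rintro hc
    rw [hc] at B1
    simp at B1
  have e3 : T 1 1 + T 1 2 * k = 0 :=
    (mul_eq_zero.1 C1.symm).resolve_right (pow_ne_zero 2 hc)
  have e4 : 0 < T 2 1 + T 2 2 * k := by
    by_contra hneg
    have := mul_nonneg (neg_nonneg.2 (not_lt.1 hneg)) (sq_nonneg c)
    linarith
  obtain rfl := eq_umbrellaRotation hT hE hD hE2 hD2 e0pos e1 e2 e3 e4
  obtain ⟨⟨-, q1, q2, q3⟩, -, q4, q5, q6⟩ :=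
    umbrellaRotation_coeff (g2 := g2) (h2 := h2) (m := m) hE hD hD2
  have q0 : umbrellaRotation E D g1 h1 k 0 0 + umbrellaRotation E D g1 h1 k 0 1 * g1
      + umbrellaRotation E D g1 h1 k 0 2 * h1 = E := by
    simp [umbrellaRotation]
    field_simp
    linear_combination -hE2
  rw [q0] at e0
  rw [q1, q2, q3] at A1
  rw [q2, q3] at B1
  rw [q4, q5, q6] at A2
  rw [q5, q6] at B2
  rw [q6] at C2
  have va : a = 1 / E := by field_simp; linarith
  have vc : c = -(E * D) / m := by
    rw [va] at B1
    field_simp at B1 ⊢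
    linarith
  have vb : b = (k * g2 - h2) / (2 * E * m) := by
    rw [va] at A1
    field_simp at A1 ⊢
    linarith
  rw [va, vb] at A2
  rw [va, vb, vc] at B2
  rw [vc] at C2
  refine ⟨?_, ?_, ?_⟩
  · rw [show x = 2 * (x / 2) by ring, A2]
    field_simp
    ring
  · rw [B2]
    field_simp
    ring
  · rw [show z = 2 * (z / 2) by ring, C2]
    field_simp

/-- The coordinate change is built from the values forced by uniqueness: `b` and `l` are the
derivatives of the second component of `φ`. -/
theorem HasUmbrellaJet.hasBruceWestInvariants (hs : IsSmoothGerm f p)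
    (hf : HasUmbrellaJet f p g1 g2 h1 h2 m k)
    (hm : m ≠ 0) (hE : 0 < E) (hD : 0 < D)
    (hE2 : E ^ 2 = 1 + g1 ^ 2 + h1 ^ 2) (hD2 : D ^ 2 = 1 + k ^ 2 + (g1 * k - h1) ^ 2) {x y z : ℝ}
    (hx : x = ((g2 * (1 + h1 ^ 2 - k * g1 * h1) + h2 * (k - g1 * h1 + k * g1 ^ 2)) / (E * D)
        + (k * g2 - h2) * (k - g1 * h1 + k * g1 ^ 2) / (E * D)
        + (h2 - k * g2) ^ 2 * D / (2 * E * m ^ 2)) / E ^ 2)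
    (hy : y = -(k - g1 * h1 + k * g1 ^ 2) / E + (h2 - k * g2) * D ^ 2 / (E * m ^ 2))
    (hz : z = 2 * E * D ^ 3 / m ^ 2) : HasBruceWestInvariants f p x y z := by
  refine ⟨by rw [hz]; positivity, ?_⟩
  have hT := umbrellaRotation_mem hE hD hE2 hD2
  obtain ⟨⟨o1, q1, q2, q3⟩, o2, q4, q5, q6⟩ :=
    umbrellaRotation_coeff (g2 := g2) (h2 := h2) (m := m) hE hD hD2
  have q0 : umbrellaRotation E D g1 h1 k 0 0 + umbrellaRotation E D g1 h1 k 0 1 * g1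
      + umbrellaRotation E D g1 h1 k 0 2 * h1 = E := by
    simp [umbrellaRotation]
    field_simp
    linear_combination -hE2
  set T := umbrellaRotation E D g1 h1 k
  have hsT : ∀ i, IsSmoothGerm (fun q => (T *ᵥ (f q - f p)) i) p := fun i => by
    simp only [Matrix.mulVec, dotProduct, Fin.sum_univ_three, Pi.sub_apply]
    exact ((IsSmoothGerm.mul (.const _ _) ((hs.apply 0).sub (.const _ _))).add
      (.mul (.const _ _) ((hs.apply 1).sub (.const _ _)))).add
      (.mul (.const _ _) ((hs.apply 2).sub (.const _ _)))
  let l := -(E * D) / m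
  have hl : l ≠ 0 := by
    have : E * D ≠ 0 := by positivity
    simp only [l]
    exact div_ne_zero (neg_ne_zero.2 this) hm
  let b := (k * g2 - h2) / (2 * E * m)
  -- `φ` will be the local inverse of `G`. The first component of `G` is that of the rotated map, so
  -- it becomes exactly `x`; the second is chosen so that `φ` has linear part `(x / E, b x + l y)`.
  let G : ℝ × ℝ → ℝ × ℝ := fun q =>
    ((T *ᵥ (f q - f p)) 0, (q.2 - p.2 - b * E * (q.1 - p.1)) / l)
  have hG : IsSmoothGerm G p := by
    refine (hsT 0).prodMk (ContDiff.isSmoothGerm ?_ p)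
    fun_prop
  have hGp : G p = 0 := by
    simp [G]
  let A : ℝ × ℝ →L[ℝ] ℝ × ℝ :=
    (E • ContinuousLinearMap.fst ℝ ℝ ℝ).prod
      ((1 / l) • (ContinuousLinearMap.snd ℝ ℝ ℝ - (b * E) • ContinuousLinearMap.fst ℝ ℝ ℝ))
  have hA : ∀ v, A v = (E * v.1, (v.2 - b * E * v.1) / l) := fun v => by
    simp [A]
    ring
  have hrow0 : (fun h : ℝ × ℝ => (T *ᵥ (f (p + h) - f p)) 0 - E * h.1)
      =O[𝓝 0] fun h => ‖h‖ ^ 2 := by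
    have hq11 := isBigO_fst.norm_pow_mul isBigO_fst
    have hq12 := isBigO_fst.norm_pow_mul isBigO_snd
    have hq22 := isBigO_snd.norm_pow_mul isBigO_snd
    refine (((hf.mulVec T 0).norm_pow_mono (m := 2) (by norm_num)).add
      (((hq11.const_mul_left ((T 0 1 * g2 + T 0 2 * h2) / 2)).add
      (hq12.const_mul_left (T 0 2 * m))).add
      (hq22.const_mul_left (T 0 1 + T 0 2 * k)))).congr_left fun h => ?_
    rw [q0]
    ring
  have hGd : HasFDerivAt G A p := by
    refine hasFDerivAt_of_isBigO_sq ?_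
    rw [hGp]
    have h0 : (fun _ : ℝ × ℝ => (0 : ℝ)) =O[𝓝 0] fun h : ℝ × ℝ => ‖h‖ ^ 2 := isBigO_zero _ _
    refine (hrow0.prod_left h0).congr_left
      fun h => ?_
    rw [hA]
    ext
    · simp [G]
    · simp [G]
  have hAinj : Function.Injective A := by
    rw [injective_iff_map_eq_zero]
    intro v hv
    rw [hA] at hv
    have hv1 : v.1 = 0 := by
      have := congrArg Prod.fst hv
      simpa [hE.ne'] using this
    have hv2 : v.2 = 0 := by
      have := congrArg Prod.snd hv
      simpa [hv1, hl] using this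
    exact Prod.ext hv1 hv2
  obtain ⟨φ, hφ, hφp, -, hGφ⟩ := hG.exists_local_inverse (hGd.fderiv ▸ hAinj)
  rw [hGp] at hφ hφp hGφ
  have hAφ : ∀ v, A (fderiv ℝ φ 0 v) = v := by
    have h1 : HasFDerivAt (fun q => G (φ q)) (A.comp (fderiv ℝ φ 0)) 0 :=
      HasFDerivAt.comp 0 (hφp ▸ hGd) hφ.differentiableAt.hasFDerivAt
    have h2 : HasFDerivAt (fun q => G (φ q)) (ContinuousLinearMap.id ℝ (ℝ × ℝ)) 0 :=
      (hasFDerivAt_id 0).congr_of_eventuallyEq hGφ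
    intro v
    exact DFunLike.congr_fun (h1.unique h2) v
  have hφinj : Function.Injective (fderiv ℝ φ 0) := fun v w hvw => by
    rw [← hAφ v, ← hAφ w, hvw]
  have hφ1 : (fderiv ℝ φ 0 (1, 0)).1 = 1 / E := by
    have := congrArg Prod.fst (hAφ (1, 0))
    rw [hA] at this
    rw [eq_div_iff hE.ne', mul_comm]
    exact this
  refine ⟨φ, hφ, hφp, ⟨hφinj, ?_⟩, by rw [hφ1]; positivity, T, hT, ?_⟩
  · exact LinearMap.injective_iff_surjective (f := (fderiv ℝ φ 0 : ℝ × ℝ →ₗ[ℝ] ℝ × ℝ)) |>.1 hφinj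
  -- the expansion of `φ`
  have hφ1' : (fderiv ℝ φ 0 (0, 1)).1 = 0 := by
    have := congrArg Prod.fst (hAφ (0, 1))
    rw [hA] at this
    simpa [hE.ne'] using this
  have hφ2 : (fderiv ℝ φ 0 (1, 0)).2 = b := by
    have := congrArg Prod.snd (hAφ (1, 0))
    rw [hA, hφ1] at this
    field_simp at this
    simp at this
    linarith
  have hφ2' : (fderiv ℝ φ 0 (0, 1)).2 = l := by
    have := congrArg Prod.snd (hAφ (0, 1))
    rw [hA, hφ1'] at this
    field_simp at this
    simp at this
    linarith
  have hU := isBigO_sub_linear_of_isSmoothGerm hφ.fst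
  have hV := isBigO_sub_linear_of_isSmoothGerm hφ.snd
  have d1 : ∀ v, fderiv ℝ (fun q => (φ q).1) 0 v = (fderiv ℝ φ 0 v).1 := fun v => by
    rw [fderiv.fst hφ.differentiableAt]; rfl
  have d2 : ∀ v, fderiv ℝ (fun q => (φ q).2) 0 v = (fderiv ℝ φ 0 v).2 := fun v => by
    rw [fderiv.snd hφ.differentiableAt]; rfl
  rw [d1, d1, hφ1, hφ1', hφp] at hU
  rw [d2, d2, hφ2, hφ2', hφp] at hV
  have hrow := fun i => hf.mulVec_comp T i hφ.continuousAt hφp hU hV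
  have hsφ : ∀ i, IsSmoothGerm (fun q => (T *ᵥ (f (φ q) - f p)) i) 0 := fun i =>
    (hsT i).comp' hφ hφp
  refine ⟨fun q => (T *ᵥ (f (φ q) - f p)) 1 - q.1 * q.2, fun q => (T *ᵥ (f (φ q) - f p)) 2 -
      (x * q.1 ^ 2 + 2 * y * (q.1 * q.2) + z * q.2 ^ 2) / 2, ⟨?_, ?_⟩, ⟨?_, ?_⟩, ?_⟩
  · exact (hsφ 1).sub (ContDiff.isSmoothGerm (by fun_prop) 0)
  · refine (hrow 1).congr_left fun q => ?_
    rw [o1, q1, q2, q3]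
    simp only [l, b]
    field_simp
    ring
  · exact (hsφ 2).sub (ContDiff.isSmoothGerm (by fun_prop) 0)
  · refine (hrow 2).congr_left fun q => ?_
    rw [o2, q4, q5, q6, hx, hy, hz]
    simp only [l, b]
    field_simp
    ring
  · filter_upwards [hGφ] with q hq
    have hq1 : (T *ᵥ (f (φ q) - f p)) 0 = q.1 := congrArg Prod.fst hq
    ext i
    fin_cases i
    · exact hq1
    · simp
    · simp

end BruceWest

/-! ### Partial derivatives and iterated derivatives -/

theorem DifferentiableAt.hasDerivAt_fst {f : ℝ × ℝ → ℝ} {q : ℝ × ℝ} (hf : DifferentiableAt ℝ f q) :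
    HasDerivAt (fun r => f (r, q.2)) (fderiv ℝ f q (1, 0)) q.1 :=
  hf.hasFDerivAt.comp_hasDerivAt q.1 ((hasDerivAt_id q.1).prodMk (hasDerivAt_const q.1 q.2))

theorem DifferentiableAt.hasDerivAt_comp_prodMk {f : ℝ × ℝ → ℝ} {x y : ℝ → ℝ} {x' y' t : ℝ}
    (hf : DifferentiableAt ℝ f (x t, y t)) (hx : HasDerivAt x x' t) (hy : HasDerivAt y y' t) :
    HasDerivAt (fun r => f (x r, y r))
      (fderiv ℝ f (x t, y t) (1, 0) * x' + fderiv ℝ f (x t, y t) (0, 1) * y') t := by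
  have h := HasFDerivAt.comp_hasDerivAt (f := fun r => (x r, y r)) t hf.hasFDerivAt (hx.prodMk hy)
  have e : fderiv ℝ f (x t, y t) (x', y') =
      fderiv ℝ f (x t, y t) (1, 0) * x' + fderiv ℝ f (x t, y t) (0, 1) * y' := by
    rw [show ((x', y') : ℝ × ℝ) = x' • ((1 : ℝ), (0 : ℝ)) + y' • ((0 : ℝ), (1 : ℝ)) by
      ext <;> simp]
    rw [map_add, map_smul, map_smul, smul_eq_mul, smul_eq_mul]
    ring
  rw [e] at h
  exact h

theorem IsSmoothGerm.hasDerivAt {f : ℝ → ℝ} {x : ℝ} (hf : IsSmoothGerm f x) :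
    HasDerivAt f (_root_.deriv f x) x :=
  hf.differentiableAt.hasDerivAt

theorem IsSmoothGerm.eventually_hasDerivAt {f : ℝ → ℝ} {x : ℝ} (hf : IsSmoothGerm f x) :
    ∀ᶠ y in 𝓝 x, HasDerivAt f (_root_.deriv f y) y :=
  hf.eventually_isSmoothGerm.mono fun _ hy => hy.hasDerivAt

/-- The second and third derivatives at `0` of `x² a(x)`. -/
theorem iteratedDeriv_of_eventuallyEq_sq_mul {f a : ℝ → ℝ} (ha : IsSmoothGerm a 0)
    (h : ∀ᶠ x in 𝓝 0, f x = x ^ 2 * a x) :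
    iteratedDeriv 2 f 0 = 2 * a 0 ∧ iteratedDeriv 3 f 0 = 6 * deriv a 0 := by
  have d1 : deriv f =ᶠ[𝓝 0] fun x => 2 * x * a x + x ^ 2 * deriv a x := by
    filter_upwards [h.eventually_nhds, ha.eventually_hasDerivAt] with x hx hax
    have : f =ᶠ[𝓝 x] fun x => x ^ 2 * a x := hx
    rw [this.deriv_eq]
    refine (((hasDerivAt_pow 2 x).mul hax).congr_deriv ?_).deriv
    norm_num
  have d2 : deriv (deriv f) =ᶠ[𝓝 0] fun x =>
      2 * a x + 4 * x * deriv a x + x ^ 2 * deriv (deriv a) x := by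
    filter_upwards [d1.eventuallyEq_nhds, ha.eventually_hasDerivAt,
      ha.deriv.eventually_hasDerivAt] with x hx hax hax'
    rw [hx.deriv_eq]
    refine (((((hasDerivAt_id x).const_mul 2).mul hax).add
      ((hasDerivAt_pow 2 x).mul hax')).congr_deriv ?_).deriv
    simp
    ring
  have d3 : deriv (deriv (deriv f)) 0 = 6 * deriv a 0 := by
    rw [d2.deriv_eq]
    refine ((((ha.hasDerivAt.const_mul 2).add (((hasDerivAt_id (0 : ℝ)).const_mul 4).mul
      ha.deriv.hasDerivAt)).add ((hasDerivAt_pow 2 (0 : ℝ)).mul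
      ha.deriv.deriv.hasDerivAt)).congr_deriv ?_).deriv
    simp
    ring
  constructor
  · rw [iteratedDeriv_succ, iteratedDeriv_one, d2.self_of_nhds]
    simp
  · rw [iteratedDeriv_succ, iteratedDeriv_succ, iteratedDeriv_one, d3]

theorem tendsto_prodMk_zero_right : Tendsto (fun x : ℝ => (x, (0 : ℝ))) (𝓝 0) (𝓝 0) := by
  have : ContinuousAt (fun x : ℝ => (x, (0 : ℝ))) 0 := by fun_prop
  exact this

theorem tendsto_prodMk_zero_left : Tendsto (fun x : ℝ => ((0 : ℝ), x)) (𝓝 0) (𝓝 0) := by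
  have : ContinuousAt (fun x : ℝ => ((0 : ℝ), x)) 0 := by fun_prop
  exact this

/-! ### The curve of singular points -/

namespace NormalForm

variable (N : NormalForm)

theorem f33_zero : N.f33 (0, 0) = 0 := N.f33_axis.self_of_nhds

/-- The decomposition `f33 = u² A(u) + s B(u, s)`. -/
theorem exists_f33_decomposition : ∃ (A : ℝ → ℝ) (B : ℝ × ℝ → ℝ), IsSmoothGerm A 0 ∧
    IsSmoothGerm B 0 ∧ A 0 = N.c2 ∧ deriv A 0 = N.c3 ∧ B 0 = 1 ∧
    ∀ᶠ q in 𝓝 (0 : ℝ × ℝ), N.f33 q = q.1 ^ 2 * A q.1 + q.2 * B q := by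
  obtain ⟨B, hB, hfB⟩ := N.smooth33.hadamard_snd
  have h0 : IsSmoothGerm (fun u : ℝ => N.f33 (u, 0)) 0 :=
    N.smooth33.comp' (IsSmoothGerm.prodMk (.id _) (.const _ _)) rfl
  obtain ⟨A₁, hA₁, hfA₁⟩ := h0.hadamard
  obtain ⟨A, hA, hA₁A⟩ := hA₁.hadamard
  have hA₁0 : A₁ 0 = 0 := by
    have h1 : (fun u : ℝ => N.f33 (u, 0)) =ᶠ[𝓝 0] fun u => u * A₁ u := by
      filter_upwards [hfA₁] with u hu
      rw [hu, N.f33_zero, zero_add]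
    have h2 : deriv (fun u => u * A₁ u) 0 = A₁ 0 :=
      (((hasDerivAt_id (0 : ℝ)).mul hA₁.hasDerivAt).congr_deriv (by simp)).deriv
    rw [← h2, ← h1.deriv_eq, N.f33_u_zero]
  have hfA : ∀ᶠ u in 𝓝 (0 : ℝ), N.f33 (u, 0) = u ^ 2 * A u := by
    filter_upwards [hfA₁, hA₁A] with u h1 h2
    rw [h1, h2, N.f33_zero, hA₁0]
    ring
  -- The identity `s B(0, s) = s` cannot be divided by `s` at `0`, so both sides are differentiated
  -- there.
  have hB0 : B 0 = 1 := by
    have h1 : (fun s : ℝ => s * B (0, s)) =ᶠ[𝓝 0] fun s => s := by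
      filter_upwards [tendsto_prodMk_zero_left.eventually hfB, N.f33_axis] with s h1 h2
      rw [h2] at h1
      simp only [N.f33_zero, zero_add] at h1
      exact h1.symm
    have hB' : IsSmoothGerm (fun s : ℝ => B (0, s)) 0 :=
      hB.comp' (IsSmoothGerm.prodMk (.const _ _) (.id _)) rfl
    have h2 : deriv (fun s : ℝ => s * B (0, s)) 0 = B (0, 0) :=
      (((hasDerivAt_id (0 : ℝ)).mul hB'.hasDerivAt).congr_deriv (by simp)).deriv
    change B (0, 0) = 1
    rw [← h2, h1.deriv_eq, deriv_id'']
  obtain ⟨i2, i3⟩ := iteratedDeriv_of_eventuallyEq_sq_mul hA hfA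
  refine ⟨A, B, hA, hB, ?_, ?_, hB0, ?_⟩
  · rw [c2, i2]; ring
  · rw [c3, i3]; ring
  · filter_upwards [hfB, (continuous_fst.tendsto (0 : ℝ × ℝ)).eventually hfA]
      with q h1 h2
    rw [h1, h2]

/-- The curve `u` of singular points, and the derivative of `f33` along it. -/
theorem exists_singular_curve {c20 : ℝ} (hc20 : c20 ≠ 0) (hc2 : N.c2 = c20 ^ 2) :
    ∃ u M : ℝ → ℝ, IsSmoothGerm u 0 ∧ IsSmoothGerm M 0 ∧ u 0 = 0 ∧ HasDerivAt u (1 / c20) 0 ∧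
      (∀ᶠ q in 𝓝 (0 : ℝ × ℝ), N.f33 (q.2, -q.1 ^ 2) = 0 ↔ q.2 = u q.1 ∨ q.2 = u (-q.1)) ∧
      (∀ᶠ t in 𝓝 (0 : ℝ), fderiv ℝ N.f33 (u t, -t ^ 2) (1, 0) = t * M t) ∧
      M 0 = 2 * c20 ∧ HasDerivAt M (2 * N.c3 / c20 ^ 2) 0 := by
  obtain ⟨A, B, hA, hB, hA0, hA1, hB0, hf⟩ := N.exists_f33_decomposition
  rw [hc2] at hA0
  -- square roots of `A` and `B`
  let a : ℝ → ℝ := fun x => c20 * √(A x / c20 ^ 2)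
  let b : ℝ × ℝ → ℝ := fun q => √(B q)
  have hA0' : A 0 / c20 ^ 2 = 1 := by rw [hA0]; field_simp
  have ha : IsSmoothGerm a 0 := IsSmoothGerm.mul (.const _ _)
    ((hA.div (.const _ _) (by positivity)).sqrt (by rw [hA0']; norm_num))
  have hb : IsSmoothGerm b 0 := hB.sqrt (by rw [hB0]; norm_num)
  -- Normalizing by `c20²` under the root and multiplying by `c20` outside gives `a` the sign of
  -- `c20`, so `u'(0) = 1 / c20` for either sign.
  have ha0 : a 0 = c20 := by simp only [a, hA0', Real.sqrt_one, mul_one]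
  have hb0 : b 0 = 1 := by simp only [b, hB0, Real.sqrt_one]
  have haA : ∀ᶠ x in 𝓝 (0 : ℝ), a x ^ 2 = A x := by
    have : ∀ᶠ x in 𝓝 (0 : ℝ), 0 < A x :=
      hA.continuousAt.eventually_const_lt (by rw [hA0]; positivity)
    filter_upwards [this] with x hx
    simp only [a]
    rw [mul_pow, Real.sq_sqrt (by positivity)]
    field_simp
  have hbB : ∀ᶠ q in 𝓝 (0 : ℝ × ℝ), b q ^ 2 = B q := by
    have : ∀ᶠ q in 𝓝 (0 : ℝ × ℝ), 0 < B q :=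
      hB.continuousAt.eventually_const_lt (by rw [hB0]; norm_num)
    filter_upwards [this] with q hq using Real.sq_sqrt hq.le
  -- the curve, from the equation `u a(u) = t b(u, -t²)`
  have hc : ContDiff ℝ ∞ fun q : ℝ × ℝ => (q.2, -q.1 ^ 2) := by fun_prop
  have hb' : IsSmoothGerm (fun q : ℝ × ℝ => b (q.2, -q.1 ^ 2)) 0 :=
    hb.comp' (hc.isSmoothGerm 0) (by simp)
  let Ψ : ℝ × ℝ → ℝ × ℝ := fun q => (q.1, q.2 * a q.2 - q.1 * b (q.2, -q.1 ^ 2))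
  have hΨ : IsSmoothGerm Ψ 0 :=
    IsSmoothGerm.prodMk (.fst (.id _)) (IsSmoothGerm.sub
      (.mul (.snd (.id _)) (ha.comp' (.snd (.id _)) rfl)) (.mul (.fst (.id _)) hb'))
  have hΨ0 : Ψ 0 = 0 := by simp [Ψ]
  have hinj : Function.Injective (fderiv ℝ Ψ 0) := by
    have e1 : HasFDerivAt (fun q : ℝ × ℝ => q.1) (ContinuousLinearMap.fst ℝ ℝ ℝ) 0 :=
      hasFDerivAt_fst
    have e2 : HasFDerivAt (fun q : ℝ × ℝ => q.2) (ContinuousLinearMap.snd ℝ ℝ ℝ) 0 :=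
      hasFDerivAt_snd
    have e3 : IsSmoothGerm (fun q : ℝ × ℝ => a q.2) 0 := ha.comp' (.snd (.id _)) rfl
    have e4 := e1.prodMk ((e2.mul e3.differentiableAt.hasFDerivAt).sub
      (e1.mul hb'.differentiableAt.hasFDerivAt))
    rw [show fderiv ℝ Ψ 0 = _ from e4.fderiv, injective_iff_map_eq_zero]
    intro v hv
    have hv1 : v.1 = 0 := congrArg Prod.fst hv
    have hv2 := congrArg Prod.snd hv
    simp [ha0, hv1] at hv2
    exact Prod.ext hv1 (hv2.resolve_left hc20)
  obtain ⟨φ, hφ, hφ0, hφΨ, hΨφ⟩ := hΨ.exists_local_inverse hinj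
  rw [hΨ0] at hφ hφ0 hΨφ
  let u : ℝ → ℝ := fun t => (φ (t, 0)).2
  have hu : IsSmoothGerm u 0 :=
    .snd (hφ.comp' (f := fun t : ℝ => (t, (0 : ℝ))) (IsSmoothGerm.prodMk (.id _) (.const _ _)) rfl)
  have hu0 : u 0 = 0 := congrArg Prod.snd hφ0
  have hueq : ∀ᶠ t in 𝓝 (0 : ℝ), u t * a (u t) = t * b (u t, -t ^ 2) := by
    filter_upwards [tendsto_prodMk_zero_right.eventually hΨφ] with t ht
    have h1 : (φ (t, 0)).1 = t := congrArg Prod.fst ht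
    have h2 := congrArg Prod.snd ht
    simp only [Ψ, h1] at h2
    exact sub_eq_zero.1 h2
  have huniq : ∀ᶠ q in 𝓝 (0 : ℝ × ℝ), q.2 * a q.2 = q.1 * b (q.2, -q.1 ^ 2) → q.2 = u q.1 := by
    filter_upwards [hφΨ] with q hq h
    have : Ψ q = (q.1, 0) := Prod.ext rfl (sub_eq_zero.2 h)
    rw [this] at hq
    exact (congrArg Prod.snd hq).symm
  have hγ : IsSmoothGerm (fun t : ℝ => (u t, -t ^ 2)) 0 :=
    hu.prodMk (ContDiff.isSmoothGerm (by fun_prop) 0)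
  have hγ0 : (u 0, -(0 : ℝ) ^ 2) = 0 := by simp [hu0]
  have hγt : Tendsto (fun t : ℝ => (u t, -t ^ 2)) (𝓝 0) (𝓝 0) := by
    have := hγ.continuousAt
    rwa [ContinuousAt, hγ0] at this
  have hut : Tendsto u (𝓝 0) (𝓝 0) := by
    have := hu.continuousAt
    rwa [ContinuousAt, hu0] at this
  have hneg2 : HasDerivAt (fun t : ℝ => -t ^ 2) 0 0 := by
    exact (hasDerivAt_pow 2 (0 : ℝ)).neg.congr_deriv (by simp)
  have hud : HasDerivAt u (1 / c20) 0 := by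
    have h1 := hu.hasDerivAt
    have h2 := h1.mul (HasDerivAt.comp_of_eq (0 : ℝ) ha.hasDerivAt h1 hu0.symm)
    have h3 := (hasDerivAt_id (0 : ℝ)).mul
      (hb.comp' hγ hγ0).hasDerivAt
    have h4 := h2.unique (h3.congr_of_eventuallyEq hueq)
    simp [hu0, ha0, show b (0, 0) = 1 from hb0] at h4
    rw [eq_div_of_mul_eq hc20 h4] at h1
    exact h1
  -- the quotient `u / t`
  let w : ℝ → ℝ := fun t => b (u t, -t ^ 2) / a (u t)
  have hau : IsSmoothGerm (fun t => a (u t)) 0 := ha.comp' hu hu0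
  have hbγ : IsSmoothGerm (fun t => b (u t, -t ^ 2)) 0 := hb.comp' hγ hγ0
  have hau0 : a (u 0) = c20 := by rw [hu0, ha0]
  have hbγ0 : b (u 0, -(0 : ℝ) ^ 2) = 1 := by rw [hγ0, hb0]
  have hw : IsSmoothGerm w 0 := hbγ.div hau (by rw [hau0]; exact hc20)
  have hw0 : w 0 = 1 / c20 := by simp only [w, hau0, hbγ0]
  have huw : ∀ᶠ t in 𝓝 (0 : ℝ), u t = t * w t := by
    filter_upwards [hueq, hau.continuousAt.eventually_ne (by rw [hau0]; exact hc20)] with t h1 h2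
    simp only [w]
    rw [← mul_div_assoc, ← h1]
    field_simp
  let Bu : ℝ × ℝ → ℝ := fun q => fderiv ℝ B q (1, 0)
  have hBu : IsSmoothGerm Bu 0 := hB.fderiv_apply _
  -- Substituting `u = t w` in `(f33)_u = 2 u A + u² A' - t² B_u` leaves a factor `t`; `M` is the
  -- cofactor.
  let M : ℝ → ℝ := fun t => -t * Bu (u t, -t ^ 2) + 2 * w t * A (u t) + t * w t ^ 2 * deriv A (u t)
  have hAu : IsSmoothGerm (fun t => A (u t)) 0 := hA.comp' hu hu0
  have hA'u : IsSmoothGerm (fun t => deriv A (u t)) 0 := hA.deriv.comp' hu hu0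
  have hBuγ : IsSmoothGerm (fun t => Bu (u t, -t ^ 2)) 0 := hBu.comp' hγ hγ0
  have hM : IsSmoothGerm M 0 :=
    (((IsSmoothGerm.id (0 : ℝ)).neg.mul hBuγ).add
      ((IsSmoothGerm.mul (.const _ _) hw).mul hAu)).add
      ((IsSmoothGerm.mul (.id _) (hw.pow 2)).mul hA'u)
  refine ⟨u, M, hu, hM, hu0, hud, ?_, ?_, ?_, ?_⟩
  · have hcq : Tendsto (fun q : ℝ × ℝ => (q.2, -q.1 ^ 2)) (𝓝 0) (𝓝 0) := by
      have := hc.continuous.continuousAt (x := 0)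
      rwa [ContinuousAt, show ((0 : ℝ × ℝ).2, -(0 : ℝ × ℝ).1 ^ 2) = (0 : ℝ × ℝ) by simp] at this
    -- The second factor is the first one with `t` replaced by `-t`, because `b` sees `t` only
    -- through `-t²`.
    have hsw : Tendsto (fun q : ℝ × ℝ => (-q.1, q.2)) (𝓝 0) (𝓝 0) := by
      have : ContinuousAt (fun q : ℝ × ℝ => (-q.1, q.2)) 0 := by fun_prop
      rwa [ContinuousAt, show (-(0 : ℝ × ℝ).1, (0 : ℝ × ℝ).2) = (0 : ℝ × ℝ) by simp] at this
    have hf1 : Tendsto (fun q : ℝ × ℝ => q.1) (𝓝 0) (𝓝 0) := continuous_fst.tendsto (0 : ℝ × ℝ)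
    have hf1' : Tendsto (fun q : ℝ × ℝ => -q.1) (𝓝 0) (𝓝 0) := by
      simpa using hf1.neg
    have hf2 : Tendsto (fun q : ℝ × ℝ => q.2) (𝓝 0) (𝓝 0) := continuous_snd.tendsto (0 : ℝ × ℝ)
    filter_upwards [hcq.eventually hf, hcq.eventually hbB, hf2.eventually haA, huniq,
      hsw.eventually huniq, hf1.eventually hueq, hf1'.eventually hueq]
      with q e1 e2 e3 e4 e5 e6 e7
    simp only [even_two, Even.neg_pow] at e5 e7
    have hfac : N.f33 (q.2, -q.1 ^ 2) = (q.2 * a q.2 - q.1 * b (q.2, -q.1 ^ 2))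
        * (q.2 * a q.2 - -q.1 * b (q.2, -q.1 ^ 2)) := by
      rw [e1, ← e2, ← e3]
      ring
    rw [hfac, mul_eq_zero, sub_eq_zero, sub_eq_zero]
    constructor
    · rintro (h | h)
      · exact Or.inl (e4 h)
      · exact Or.inr (e5 h)
    · rintro (h | h)
      · left; rw [h]; exact e6
      · right; rw [h]; exact e7
  · filter_upwards [hγt.eventually hf.eventually_nhds, hγt.eventually hB.eventually_isSmoothGerm,
      hut.eventually hA.eventually_isSmoothGerm, huw] with t h1 h2 h3 h4
    have h5 : N.f33 =ᶠ[𝓝 (u t, -t ^ 2)] fun q => q.1 ^ 2 * A q.1 + q.2 * B q := h1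
    have h6 : DifferentiableAt ℝ (fun q : ℝ × ℝ => q.1 ^ 2 * A q.1 + q.2 * B q) (u t, -t ^ 2) := by
      have h7 : DifferentiableAt ℝ (fun q : ℝ × ℝ => A q.1) (u t, -t ^ 2) :=
        DifferentiableAt.comp (u t, -t ^ 2) (g := A) h3.differentiableAt differentiableAt_fst
      exact ((differentiableAt_fst.pow 2).mul h7).add (differentiableAt_snd.mul h2.differentiableAt)
    rw [h5.fderiv_eq]
    have h8 := h6.hasDerivAt_fst.unique (((hasDerivAt_pow 2 (u t)).mul h3.hasDerivAt).add
      (h2.differentiableAt.hasDerivAt_fst.const_mul (-t ^ 2)))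
    rw [h8]
    simp only [M, Bu]
    norm_num
    -- Hides the occurrences of `u t` inside function arguments, so that `h4` rewrites only the
    -- polynomial ones.
    generalize deriv A (u t) = α
    generalize A (u t) = β
    generalize (fderiv ℝ B (u t, -t ^ 2)) (1, 0) = δ
    rw [h4]
    ring
  · simp only [M, hw0, hu0, hA0]
    field_simp
    ring
  · have hbd := hb.differentiableAt
    have k1 : HasDerivAt (fun t => b (u t, -t ^ 2)) (fderiv ℝ b 0 (1, 0) / c20) 0 := by
      have := DifferentiableAt.hasDerivAt_comp_prodMk (x := u) (y := fun t => -t ^ 2) (t := 0)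
        (by rw [hγ0]; exact hbd) hud hneg2
      rw [hγ0] at this
      exact this.congr_deriv (by ring)
    have k2 : HasDerivAt (fun t => a (u t)) (deriv a 0 / c20) 0 :=
      (HasDerivAt.comp_of_eq (0 : ℝ) ha.hasDerivAt hud hu0.symm).congr_deriv (by ring)
    have k3 : HasDerivAt (fun t => A (u t)) (N.c3 / c20) 0 :=
      (HasDerivAt.comp_of_eq (0 : ℝ) hA.hasDerivAt hud hu0.symm).congr_deriv (by rw [hA1]; ring)
    have hw1 : HasDerivAt w _ 0 := k1.div k2 (by rw [hau0]; exact hc20)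
    have hM1 := ((((hasDerivAt_id (0 : ℝ)).neg.mul hBuγ.hasDerivAt).add
      ((hw1.const_mul 2).mul k3)).add
      (((hasDerivAt_id (0 : ℝ)).mul (hw1.pow 2)).mul hA'u.hasDerivAt))
    -- Differentiating `a² = A` and `b² = B` at the origin expresses everything by `c3` and `b_u`;
    -- the terms in `b_u` cancel in `M'(0)`.
    have ea : N.c3 = 2 * c20 * deriv a 0 := by
      have h1 := (ha.hasDerivAt.pow 2).unique
        (hA.hasDerivAt.congr_of_eventuallyEq haA)
      rw [hA1, ha0] at h1
      rw [← h1]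
      norm_num
    have eb : Bu 0 = 2 * fderiv ℝ b 0 (1, 0) := by
      have h0 : (fun q => b q ^ 2) =ᶠ[𝓝 0] B := hbB
      have h1 := (hbd.hasFDerivAt.pow 2).unique
        (hB.differentiableAt.hasFDerivAt.congr_of_eventuallyEq h0)
      have h2 := DFunLike.congr_fun h1 (1, 0)
      simp [hb0] at h2
      exact h2.symm
    refine hM1.congr_deriv ?_
    simp only [Pi.neg_apply, Pi.mul_apply, Pi.pow_apply, id, hw0, hau0, hγ0, hb0, eb]
    simp only [hu0, hA0, hA1]
    rw [ea]
    field_simp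
    ring

end NormalForm

/-! ### Whitney's criterion from the 2-jet -/

section Whitney

variable {f : ℝ × ℝ → Fin 3 → ℝ} {p : ℝ × ℝ} {g1 g2 h1 h2 m k : ℝ}

theorem HasUmbrellaJet.fderiv_eq (hf : HasUmbrellaJet f p g1 g2 h1 h2 m k) (v : ℝ × ℝ) :
    fderiv ℝ f p v = ![v.1, g1 * v.1, h1 * v.1] := by
  let A : ℝ × ℝ →L[ℝ] Fin 3 → ℝ := ContinuousLinearMap.pi
    ![ContinuousLinearMap.fst ℝ ℝ ℝ, g1 • ContinuousLinearMap.fst ℝ ℝ ℝ,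
      h1 • ContinuousLinearMap.fst ℝ ℝ ℝ]
  have hA : ∀ v, A v = ![v.1, g1 * v.1, h1 * v.1] := fun v => by
    ext i
    fin_cases i <;> simp [A]
  have hq11 := isBigO_fst.norm_pow_mul isBigO_fst
  have hq12 := isBigO_fst.norm_pow_mul isBigO_snd
  have hq22 := isBigO_snd.norm_pow_mul isBigO_snd
  have hfA : HasFDerivAt f A p := by
    refine hasFDerivAt_of_isBigO_sq (isBigO_pi.2 fun i => ?_)
    have H := (isBigO_pi.1 hf i).norm_pow_mono (m := 2) (by norm_num)
    fin_cases i
    · exact H.congr_left fun h => by simp [hA]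
    · refine (H.add ((hq11.const_mul_left (g2 / 2)).add hq22)).congr_left fun h => ?_
      simp [hA]
      ring
    · refine (H.add ((hq11.const_mul_left (h2 / 2)).add ((hq12.const_mul_left m).add
        (hq22.const_mul_left k)))).congr_left fun h => ?_
      simp [hA]
      ring
  rw [hfA.fderiv, hA]

/-- The given jet and the Taylor polynomial differ by `O(‖h‖³)`, so their quadratic coefficients
agree. -/
theorem HasUmbrellaJet.fderiv_fderiv_eq (hs : IsSmoothGerm f p)
    (hf : HasUmbrellaJet f p g1 g2 h1 h2 m k) :
    fderiv ℝ (fderiv ℝ f) p (1, 0) (0, 1) = ![0, 0, m] ∧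
      fderiv ℝ (fderiv ℝ f) p (0, 1) (0, 1) = ![0, 2, 2 * k] := by
  have hsymm : IsSymmSndFDerivAt ℝ f p :=
    hs.contDiffAt.isSymmSndFDerivAt (by simpa using ENat.LEInfty.out)
  set B := fderiv ℝ (fderiv ℝ f) p
  have hB : ∀ (h : ℝ × ℝ) (i : Fin 3), B h h i = B (1, 0) (1, 0) i * h.1 ^ 2
      + 2 * B (1, 0) (0, 1) i * (h.1 * h.2) + B (0, 1) (0, 1) i * h.2 ^ 2 := by
    intro h i
    conv_lhs => rw [show h = h.1 • ((1 : ℝ), (0 : ℝ)) + h.2 • ((0 : ℝ), (1 : ℝ)) by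
      ext <;> simp]
    simp only [map_add, map_smul, add_apply, smul_apply, Pi.add_apply,
      Pi.smul_apply, smul_eq_mul]
    rw [show B (0, 1) (1, 0) = B (1, 0) (0, 1) from hsymm (0, 1) (1, 0)]
    ring
  have key : ∀ (i : Fin 3) (c1 c2 c3 c4 : ℝ),
      (∀ h : ℝ × ℝ, (![h.1, g1 * h.1 + g2 / 2 * h.1 ^ 2 + h.2 ^ 2,
        h1 * h.1 + h2 / 2 * h.1 ^ 2 + m * (h.1 * h.2) + k * h.2 ^ 2] : Fin 3 → ℝ) i =
        c1 * h.1 + c2 * h.1 ^ 2 + c3 * (h.1 * h.2) + c4 * h.2 ^ 2) →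
      (∀ h : ℝ × ℝ, (![h.1, g1 * h.1, h1 * h.1] : Fin 3 → ℝ) i = c1 * h.1) →
      B (1, 0) (0, 1) i = c3 ∧ B (0, 1) (0, 1) i = 2 * c4 := by
    intro i c1 c2 c3 c4 hc hc1
    have H : (fun h : ℝ × ℝ => (B (1, 0) (1, 0) i / 2 - c2) * h.1 ^ 2
        + (B (1, 0) (0, 1) i - c3) * (h.1 * h.2) + (B (0, 1) (0, 1) i / 2 - c4) * h.2 ^ 2)
        =O[𝓝 0] fun h => ‖h‖ ^ 3 := by
      refine ((isBigO_pi.1 hf i).sub (isBigO_pi.1 hs.taylor_two i)).congr_left fun h => ?_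
      simp only [Pi.sub_apply, Pi.smul_apply, smul_eq_mul, hf.fderiv_eq, hc, hc1]
      rw [show fderiv ℝ (fderiv ℝ f) p h h i = B h h i from rfl, hB]
      ring
    obtain ⟨-, e2, e3⟩ := quadratic_coeff_eq_zero H
    exact ⟨by linarith, by linarith⟩
  obtain ⟨a0, b0⟩ := key 0 1 0 0 0 (fun h => by simp) (fun h => by simp)
  obtain ⟨a1, b1⟩ := key 1 g1 (g2 / 2) 0 1 (fun h => by simp) (fun h => by simp)
  obtain ⟨a2, b2⟩ := key 2 h1 (h2 / 2) m k (fun h => by simp) (fun h => by simp)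
  constructor
  · ext i
    fin_cases i
    · exact a0
    · exact a1
    · exact a2
  · ext i
    fin_cases i
    · simpa using b0
    · simpa using b1
    · exact b2

theorem HasUmbrellaJet.isWhitneyUmbrella (hs : IsSmoothGerm f p)
    (hf : HasUmbrellaJet f p g1 g2 h1 h2 m k) (hm : m ≠ 0) : IsWhitneyUmbrella f p := by
  obtain ⟨huv, hvv⟩ := hf.fderiv_fderiv_eq hs
  refine ⟨hs, (1, 0), (0, 1), ?_, ?_⟩
  · rw [hf.fderiv_eq]
    ext i
    fin_cases i <;> simp
  · rw [hf.fderiv_eq, huv, hvv]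
    -- The determinant is `-2 m`.
    refine Matrix.linearIndependent_rows_of_det_ne_zero
      (A := !![(1 : ℝ), g1 * 1, h1 * 1; 0, 0, m; 0, 2, 2 * k]) ?_
    rw [Matrix.det_fin_three]
    simpa using hm

end Whitney

/-! ### The 2-jets of the normal form -/

namespace NormalForm

variable (N : NormalForm)

/-- The restriction of the second component of the normal form to `v = 0`. -/
def axis2 (q : ℝ × ℝ) : ℝ := q.1 ^ 2 * N.f21 q.1 + q.1 * q.2 * N.f24 q

/-- The restriction of the third component of the normal form to `v = 0`. -/
def axis3 (q : ℝ × ℝ) : ℝ := q.1 ^ 2 * N.f31 q.1 + q.1 * q.2 * N.f34 q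

theorem map_eq (s : ℝ) (p : ℝ × ℝ) : N.map s p = ![p.1, N.axis2 (p.1, s) + p.2 ^ 2,
    N.axis3 (p.1, s) + p.2 ^ 2 * N.f32 (p.1, p.2, s) + p.2 * N.f33 (p.1, s)] := by
  ext i
  fin_cases i
  · rfl
  · simp [map, axis2]
    ring
  · simp [map, axis3]
    ring

theorem isSmoothGerm_sq_mul_add {α : ℝ → ℝ} {β : ℝ × ℝ → ℝ} (hα : IsSmoothGerm α 0)
    (hβ : IsSmoothGerm β 0) :
    IsSmoothGerm (fun q : ℝ × ℝ => q.1 ^ 2 * α q.1 + q.1 * q.2 * β q) 0 :=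
  IsSmoothGerm.add (.mul (.pow (.fst (.id _)) 2) (hα.comp' (.fst (.id _)) rfl))
    (.mul (.mul (.fst (.id _)) (.snd (.id _))) hβ)

theorem smooth_axis2 : IsSmoothGerm N.axis2 0 := isSmoothGerm_sq_mul_add N.smooth21 N.smooth24

theorem smooth_axis3 : IsSmoothGerm N.axis3 0 := isSmoothGerm_sq_mul_add N.smooth31 N.smooth34

theorem isSmoothGerm_map {s : ℝ} {p : ℝ × ℝ} (h2 : IsSmoothGerm N.axis2 (p.1, s))
    (h3 : IsSmoothGerm N.axis3 (p.1, s)) (h32 : IsSmoothGerm N.f32 (p.1, p.2, s))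
    (h33 : IsSmoothGerm N.f33 (p.1, s)) : IsSmoothGerm (N.map s) p := by
  have e : IsSmoothGerm (fun q : ℝ × ℝ => (q.1, s)) p :=
    IsSmoothGerm.prodMk (.fst (.id _)) (.const _ _)
  have e' : IsSmoothGerm (fun q : ℝ × ℝ => (q.1, q.2, s)) p :=
    IsSmoothGerm.prodMk (.fst (.id _)) (.prodMk (.snd (.id _)) (.const _ _))
  have v : IsSmoothGerm (fun q : ℝ × ℝ => q.2) p := .snd (.id _)
  refine IsSmoothGerm.pi fun i => ?_
  simp only [map_eq]
  fin_cases i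
  · exact .fst (.id _)
  · exact (h2.comp' e rfl).add (v.pow 2)
  · exact ((h3.comp' e rfl).add ((v.pow 2).mul (h32.comp' e' rfl))).add (v.mul (h33.comp' e rfl))

theorem taylor_two_fst {F : ℝ × ℝ → ℝ} {q : ℝ × ℝ} (hF : IsSmoothGerm F q) :
    (fun h : ℝ × ℝ => F (q.1 + h.1, q.2) - F q - (fderiv ℝ F q (1, 0) * h.1
      + fderiv ℝ (fderiv ℝ F) q (1, 0) (1, 0) / 2 * h.1 ^ 2)) =O[𝓝 0] fun h => ‖h‖ ^ 3 := by
  have ht : Tendsto (fun h : ℝ × ℝ => (h.1, (0 : ℝ))) (𝓝 0) (𝓝 0) := by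
    have : ContinuousAt (fun q : ℝ × ℝ => (q.1, (0 : ℝ))) 0 := by fun_prop
    exact this
  have hO : (fun h : ℝ × ℝ => ‖(h.1, (0 : ℝ))‖ ^ 3) =O[𝓝 0] fun h => ‖h‖ ^ 3 := by
    refine IsBigO.of_bound 1 (Eventually.of_forall fun h => ?_)
    simp only [norm_pow, norm_norm, one_mul]
    gcongr
    simp [Prod.norm_def]
  refine ((hF.taylor_two.comp_tendsto ht).trans hO).congr_left fun h => ?_
  simp only [Function.comp_apply]
  rw [show ((h.1, 0) : ℝ × ℝ) = h.1 • ((1 : ℝ), (0 : ℝ)) by simp]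
  simp only [map_smul, smul_apply, smul_eq_mul]
  rw [show q + h.1 • ((1 : ℝ), (0 : ℝ)) = (q.1 + h.1, q.2) by ext <;> simp]
  ring

/-- The 2-jet of `f^s` at a singular point. -/
theorem hasUmbrellaJet_map {u s : ℝ} (h2 : IsSmoothGerm N.axis2 (u, s))
    (h3 : IsSmoothGerm N.axis3 (u, s)) (h32 : IsSmoothGerm N.f32 (u, 0, s))
    (h33 : IsSmoothGerm N.f33 (u, s)) (h0 : N.f33 (u, s) = 0) :
    HasUmbrellaJet (N.map s) (u, 0)
      (fderiv ℝ N.axis2 (u, s) (1, 0)) (fderiv ℝ (fderiv ℝ N.axis2) (u, s) (1, 0) (1, 0))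
      (fderiv ℝ N.axis3 (u, s) (1, 0)) (fderiv ℝ (fderiv ℝ N.axis3) (u, s) (1, 0) (1, 0))
      (fderiv ℝ N.f33 (u, s) (1, 0)) (N.f32 (u, 0, s)) := by
  -- In the third component `f33` is multiplied by `v` and `f32` by `v²`, so expansions with errors
  -- of order two and one suffice.
  have t33 : (fun h : ℝ × ℝ => N.f33 (u + h.1, s) - fderiv ℝ N.f33 (u, s) (1, 0) * h.1)
      =O[𝓝 0] fun h => ‖h‖ ^ 2 := by
    have hq := (isBigO_fst.norm_pow_mul isBigO_fst).const_mul_left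
      (fderiv ℝ (fderiv ℝ N.f33) (u, s) (1, 0) (1, 0) / 2)
    refine (((taylor_two_fst h33).norm_pow_mono (m := 2) (by norm_num)).add hq).congr_left
      fun h => ?_
    simp only [h0]
    ring
  have t32 : (fun h : ℝ × ℝ => N.f32 (u + h.1, h.2, s) - N.f32 (u, 0, s))
      =O[𝓝 0] fun h => ‖h‖ ^ 1 := by
    have e : IsSmoothGerm (fun q : ℝ × ℝ => N.f32 (q.1, q.2, s)) (u, 0) :=
      h32.comp' (f := fun q : ℝ × ℝ => (q.1, q.2, s))
        (IsSmoothGerm.prodMk (.fst (.id _)) (.prodMk (.snd (.id _)) (.const _ _))) rfl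
    simpa using e.taylor_zero
  have hv2 := isBigO_snd.norm_pow_mul isBigO_snd
  refine isBigO_pi.2 fun i => ?_
  simp only [map_eq]
  fin_cases i
  · refine (isBigO_zero _ _).congr_left fun h => ?_
    simp
  · refine (taylor_two_fst h2).congr_left fun h => ?_
    simp
    ring
  · refine ((taylor_two_fst h3).add ((hv2.norm_pow_mul t32).add
      (isBigO_snd.norm_pow_mul t33))).congr_left fun h => ?_
    simp
    ring

/-- The singular points of `f^s`. -/
theorem isSingularPoint_map_iff {s : ℝ} {p : ℝ × ℝ} (h2 : IsSmoothGerm N.axis2 (p.1, s))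
    (h3 : IsSmoothGerm N.axis3 (p.1, s)) (h32 : IsSmoothGerm N.f32 (p.1, p.2, s))
    (h33 : IsSmoothGerm N.f33 (p.1, s)) :
    IsSingularPoint (N.map s) p ↔ p.2 = 0 ∧ N.f33 (p.1, s) = 0 := by
  have hs := (N.isSmoothGerm_map h2 h3 h32 h33).differentiableAt
  have hfst : ∀ v, fderiv ℝ (N.map s) p v 0 = v.1 := fun v => by
    have e1 := hasFDerivAt_pi'.1 hs.hasFDerivAt 0
    have e2 : HasFDerivAt (fun q : ℝ × ℝ => N.map s q 0) (ContinuousLinearMap.fst ℝ ℝ ℝ) p :=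
      hasFDerivAt_fst
    exact DFunLike.congr_fun (e1.unique e2) v
  have e32 : IsSmoothGerm (fun r : ℝ => N.f32 (p.1, r, s)) p.2 :=
    h32.comp' (f := fun r : ℝ => (p.1, r, s))
      (IsSmoothGerm.prodMk (.const _ _) (.prodMk (.id _) (.const _ _))) rfl
  have hsnd : fderiv ℝ (N.map s) p (0, 1) = ![0, 2 * p.2, 2 * p.2 * N.f32 (p.1, p.2, s)
      + p.2 ^ 2 * deriv (fun r : ℝ => N.f32 (p.1, r, s)) p.2 + N.f33 (p.1, s)] := by
    have d1 : HasDerivAt (fun r : ℝ => N.map s (p.1, r)) (fderiv ℝ (N.map s) p (0, 1)) p.2 :=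
      HasFDerivAt.comp_hasDerivAt (l := N.map s) p.2 hs.hasFDerivAt ((hasDerivAt_const p.2 p.1).prodMk (hasDerivAt_id p.2))
    refine d1.unique (hasDerivAt_pi.2 fun i => ?_)
    simp only [map_eq]
    fin_cases i
    · exact hasDerivAt_const _ _
    · refine ((hasDerivAt_const p.2 (N.axis2 (p.1, s))).add (hasDerivAt_pow 2 p.2)).congr_deriv ?_
      simp
    · refine (((hasDerivAt_const p.2 (N.axis3 (p.1, s))).add ((hasDerivAt_pow 2 p.2).mul
        e32.hasDerivAt)).add ((hasDerivAt_id p.2).mul_const (N.f33 (p.1, s)))).congr_deriv ?_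
      simp
  -- As the first component of the map is `u`, a kernel vector is a multiple of `(0, 1)`.
  have hker : IsSingularPoint (N.map s) p ↔ fderiv ℝ (N.map s) p (0, 1) = 0 := by
    rw [IsSingularPoint, injective_iff_map_eq_zero]
    constructor
    · intro h
      push Not at h
      obtain ⟨v, hv, hv0⟩ := h
      have hv1 : v.1 = 0 := by rw [← hfst v, hv]; rfl
      have hv2 : v.2 ≠ 0 := fun h => hv0 (Prod.ext hv1 h)
      rw [show v = v.2 • ((0 : ℝ), (1 : ℝ)) by ext <;> simp [hv1], map_smul] at hv
      exact (smul_eq_zero.1 hv).resolve_left hv2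
    · intro h h'
      have := h' _ h
      simp at this
  rw [hker, hsnd]
  constructor
  · intro h
    have h1 := congrFun h 1
    have h2 := congrFun h 2
    simp at h1 h2
    refine ⟨h1, ?_⟩
    simpa [h1] using h2
  · rintro ⟨h1, h2⟩
    ext i
    fin_cases i <;> simp [h1, h2]

end NormalForm

/-! ### The expansions -/

theorem IsSmoothGerm.isTermO_one {S : ℝ → ℝ} (hS : IsSmoothGerm S 0) {c : ℝ} (hc : S 0 = c) :
    IsTermO 1 fun t => S t - c := by
  subst hc
  refine ⟨hS.sub (.const _ _), ?_⟩
  simpa using hS.taylor_zero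

theorem IsSmoothGerm.isTermO_two {S : ℝ → ℝ} (hS : IsSmoothGerm S 0) {c d : ℝ}
    (hc : S 0 = c) (hd : HasDerivAt S d 0) : IsTermO 2 fun t => S t - c - d * t := by
  subst hc
  refine ⟨(hS.sub (.const _ _)).sub (ContDiff.isSmoothGerm (by fun_prop) 0), ?_⟩
  refine hS.taylor_one.congr_left fun t => ?_
  rw [hd.hasFDerivAt.fderiv]
  simp
  ring

theorem IsSmoothGerm.fderiv_fderiv_apply {F : ℝ × ℝ → ℝ} {q : ℝ × ℝ} (hF : IsSmoothGerm F q)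
    (v w : ℝ × ℝ) :
    _root_.fderiv ℝ (_root_.fderiv ℝ F) q v w =
      _root_.fderiv ℝ (fun y => _root_.fderiv ℝ F y w) q v := by
  rw [(hF.fderiv.differentiableAt.hasFDerivAt.clm_apply (hasFDerivAt_const w q)).fderiv]
  simp

theorem fderiv_sq_mul_add {α : ℝ → ℝ} {β : ℝ × ℝ → ℝ} (hα : IsSmoothGerm α 0)
    (hβ : IsSmoothGerm β 0) :
    ∀ᶠ q in 𝓝 (0 : ℝ × ℝ),
      fderiv ℝ (fun q : ℝ × ℝ => q.1 ^ 2 * α q.1 + q.1 * q.2 * β q) q (1, 0) =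
        2 * q.1 * α q.1 + q.1 ^ 2 * deriv α q.1 + q.2 * (β q + q.1 * fderiv ℝ β q (1, 0)) := by
  filter_upwards [(NormalForm.isSmoothGerm_sq_mul_add hα hβ).eventually_isSmoothGerm,
    (continuous_fst.tendsto (0 : ℝ × ℝ)).eventually hα.eventually_isSmoothGerm,
    hβ.eventually_isSmoothGerm] with q h1 h2 h3
  refine h1.differentiableAt.hasDerivAt_fst.unique ?_
  refine ((((hasDerivAt_pow 2 q.1).mul h2.hasDerivAt)).add
    ((((hasDerivAt_id q.1).mul_const q.2)).mul
      h3.differentiableAt.hasDerivAt_fst)).congr_deriv ?_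
  simp
  ring

/-- On the curve the second coordinate is `-t²`, so the term with `K` is invisible to first order in
`t`; only smoothness of `K` is recorded. -/
theorem exists_fderiv_fderiv_sq_mul_add {α : ℝ → ℝ} {β : ℝ × ℝ → ℝ} (hα : IsSmoothGerm α 0)
    (hβ : IsSmoothGerm β 0) :
    ∃ K : ℝ × ℝ → ℝ, IsSmoothGerm K 0 ∧ ∀ᶠ q in 𝓝 (0 : ℝ × ℝ),
      fderiv ℝ (fderiv ℝ fun q : ℝ × ℝ => q.1 ^ 2 * α q.1 + q.1 * q.2 * β q) q (1, 0) (1, 0) =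
        2 * α q.1 + 4 * q.1 * deriv α q.1 + q.1 ^ 2 * deriv (deriv α) q.1 + q.2 * K q := by
  have hβ' := hβ.fderiv_apply (1, 0)
  have hF := NormalForm.isSmoothGerm_sq_mul_add hα hβ
  refine ⟨fun q => 2 * fderiv ℝ β q (1, 0)
    + q.1 * fderiv ℝ (fun y => fderiv ℝ β y (1, 0)) q (1, 0),
    (IsSmoothGerm.mul (.const _ _) hβ').add (.mul (.fst (.id _)) (hβ'.fderiv_apply _)), ?_⟩
  filter_upwards [hF.eventually_isSmoothGerm,
    (hF.fderiv_apply (1, 0)).eventually_isSmoothGerm, (fderiv_sq_mul_add hα hβ).eventually_nhds,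
    (continuous_fst.tendsto (0 : ℝ × ℝ)).eventually hα.eventually_isSmoothGerm,
    hβ.eventually_isSmoothGerm, hβ'.eventually_isSmoothGerm] with q h1 h1' he h2 h3 h4
  rw [h1.fderiv_fderiv_apply]
  have he' : (fun y => fderiv ℝ (fun q : ℝ × ℝ => q.1 ^ 2 * α q.1 + q.1 * q.2 * β q) y (1, 0))
      =ᶠ[𝓝 q] fun q => 2 * q.1 * α q.1 + q.1 ^ 2 * deriv α q.1
        + q.2 * (β q + q.1 * fderiv ℝ β q (1, 0)) := he
  have h5 := (h1'.congr he'.symm).differentiableAt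
  rw [he'.fderiv_eq]
  refine h5.hasDerivAt_fst.unique ?_
  refine ((((((hasDerivAt_id q.1).const_mul 2).mul h2.hasDerivAt)).add
    ((hasDerivAt_pow 2 q.1).mul h2.deriv.hasDerivAt)).add
    (((h3.differentiableAt.hasDerivAt_fst).add
      ((hasDerivAt_id q.1).mul h4.differentiableAt.hasDerivAt_fst)).const_mul q.2)).congr_deriv ?_
  simp
  ring

/-- The coefficients of an umbrella along the curve of singular points, and what is known of
their Taylor expansions. -/
theorem umbrella_expansions {g1 g2 h1 h2 k M : ℝ → ℝ} (hg1 : IsSmoothGerm g1 0)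
    (hg2 : IsSmoothGerm g2 0) (hh1 : IsSmoothGerm h1 0) (hh2 : IsSmoothGerm h2 0)
    (hk : IsSmoothGerm k 0) (hM : IsSmoothGerm M 0) (g10 : g1 0 = 0) (h10 : h1 0 = 0)
    (k0 : k 0 = 0) (M0 : M 0 ≠ 0) {h2' k' M' : ℝ} (dh2 : HasDerivAt h2 h2' 0)
    (dk : HasDerivAt k k' 0) (dM : HasDerivAt M M' 0) :
    ∃ E D : ℝ → ℝ, (∀ t, 0 < E t) ∧ (∀ t, 0 < D t) ∧
      (∀ t, E t ^ 2 = 1 + g1 t ^ 2 + h1 t ^ 2) ∧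
      (∀ t, D t ^ 2 = 1 + k t ^ 2 + (g1 t * k t - h1 t) ^ 2) ∧
      IsTermO 2 (fun t => ((t ^ 2 * (g2 t * (1 + h1 t ^ 2 - k t * g1 t * h1 t)
          + h2 t * (k t - g1 t * h1 t + k t * g1 t ^ 2)) / (E t * D t)
        + t ^ 2 * ((k t * g2 t - h2 t) * (k t - g1 t * h1 t + k t * g1 t ^ 2)) / (E t * D t)
        + (h2 t - k t * g2 t) ^ 2 * D t / (2 * E t * M t ^ 2)) / E t ^ 2)
        - h2 0 ^ 2 / (2 * M 0 ^ 2)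
        - (h2 0 * (h2' - k' * g2 0) / M 0 ^ 2 - h2 0 ^ 2 * M' / M 0 ^ 3) * t) ∧
      IsTermO 2 (fun t => (t ^ 2 * -(k t - g1 t * h1 t + k t * g1 t ^ 2) / E t
          + (h2 t - k t * g2 t) * D t ^ 2 / (E t * M t ^ 2))
        - h2 0 / M 0 ^ 2
        - ((h2' - k' * g2 0) / M 0 ^ 2 - 2 * h2 0 * M' / M 0 ^ 3) * t) ∧
      IsTermO 1 (fun t => 2 * E t * D t ^ 3 / M t ^ 2 - 2 / M 0 ^ 2) := by
  let E2 : ℝ → ℝ := fun t => 1 + g1 t ^ 2 + h1 t ^ 2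
  let D2 : ℝ → ℝ := fun t => 1 + k t ^ 2 + (g1 t * k t - h1 t) ^ 2
  have E2pos : ∀ t, 0 < E2 t := fun t => by positivity
  have D2pos : ∀ t, 0 < D2 t := fun t => by positivity
  have hE2 : IsSmoothGerm E2 0 := (IsSmoothGerm.add (.const _ _) (hg1.pow 2)).add (hh1.pow 2)
  have hD2 : IsSmoothGerm D2 0 :=
    (IsSmoothGerm.add (.const _ _) (hk.pow 2)).add (((hg1.mul hk).sub hh1).pow 2)
  have hE : IsSmoothGerm (fun t => √(E2 t)) 0 := hE2.sqrt (E2pos 0).ne'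
  have hD : IsSmoothGerm (fun t => √(D2 t)) 0 := hD2.sqrt (D2pos 0).ne'
  have E20 : E2 0 = 1 := by simp [E2, g10, h10]
  have D20 : D2 0 = 1 := by simp [D2, g10, h10, k0]
  -- `g1`, `h1` and `k` vanish at `0`, so `E²` and `D²` differ from `1` by squares of vanishing
  -- germs, and `E`, `D` do not affect the first-order terms.
  have dE2 : HasDerivAt E2 0 0 := by
    refine (((hasDerivAt_const (0 : ℝ) (1 : ℝ)).add (hg1.hasDerivAt.pow 2)).add
      (hh1.hasDerivAt.pow 2)).congr_deriv ?_
    simp [g10, h10]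
  have dD2 : HasDerivAt D2 0 0 := by
    refine (((hasDerivAt_const (0 : ℝ) (1 : ℝ)).add (dk.pow 2)).add
      (((hg1.hasDerivAt.mul dk).sub hh1.hasDerivAt).pow 2)).congr_deriv ?_
    simp [g10, h10, k0]
  have dE : HasDerivAt (fun t => √(E2 t)) 0 0 := by
    simpa using dE2.sqrt (E2pos 0).ne'
  have dD : HasDerivAt (fun t => √(D2 t)) 0 0 := by
    simpa using dD2.sqrt (D2pos 0).ne'
  have E0 : √(E2 0) = 1 := by rw [E20, Real.sqrt_one]
  have D0 : √(D2 0) = 1 := by rw [D20, Real.sqrt_one]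
  have Epos : ∀ t, 0 < √(E2 t) := fun t => Real.sqrt_pos.2 (E2pos t)
  have Dpos : ∀ t, 0 < √(D2 t) := fun t => Real.sqrt_pos.2 (D2pos t)
  have hEsq : ∀ t, √(E2 t) ^ 2 = E2 t := fun t => Real.sq_sqrt (E2pos t).le
  have hDsq : ∀ t, √(D2 t) ^ 2 = D2 t := fun t => Real.sq_sqrt (D2pos t).le
  set E : ℝ → ℝ := fun t => √(E2 t)
  set D : ℝ → ℝ := fun t => √(D2 t)
  have E0 : E 0 = 1 := E0
  have D0 : D 0 = 1 := D0
  let κ : ℝ → ℝ := fun t => k t - g1 t * h1 t + k t * g1 t ^ 2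
  have hκ : IsSmoothGerm κ 0 := (hk.sub (hg1.mul hh1)).add (hk.mul (hg1.pow 2))
  have ht2 : IsSmoothGerm (fun t : ℝ => t ^ 2) 0 := ContDiff.isSmoothGerm (by fun_prop) 0
  have dt2 : HasDerivAt (fun t : ℝ => t ^ 2) 0 0 :=
    (hasDerivAt_pow 2 (0 : ℝ)).congr_deriv (by simp)
  have hσ : IsSmoothGerm (fun t => h2 t - k t * g2 t) 0 := hh2.sub (hk.mul hg2)
  have dσ : HasDerivAt (fun t => h2 t - k t * g2 t) (h2' - k' * g2 0) 0 :=
    (dh2.sub (dk.mul hg2.hasDerivAt)).congr_deriv (by simp [k0])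
  have hP : IsSmoothGerm (fun t => g2 t * (1 + h1 t ^ 2 - k t * g1 t * h1 t) + h2 t * κ t) 0 :=
    (hg2.mul ((IsSmoothGerm.add (.const _ _) (hh1.pow 2)).sub ((hk.mul hg1).mul hh1))).add
      (hh2.mul hκ)
  have hQ : IsSmoothGerm (fun t => (k t * g2 t - h2 t) * κ t) 0 :=
    ((hk.mul hg2).sub hh2).mul hκ
  have hED : E 0 * D 0 ≠ 0 := by simp [E0, D0]
  have hEM : E 0 * M 0 ^ 2 ≠ 0 := by simp [E0, M0]
  have h2EM : 2 * E 0 * M 0 ^ 2 ≠ 0 := by simp [E0, M0]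
  have hE02 : E 0 ^ 2 ≠ 0 := by simp [E0]
  refine ⟨E, D, Epos, Dpos, hEsq, hDsq, ?_, ?_, ?_⟩
  -- The two summands with factor `t²` contribute neither a value nor a derivative at `0`; only the
  -- last one does.
  · have hS := ((((ht2.mul hP).div (hE.mul hD) hED).add ((ht2.mul hQ).div (hE.mul hD) hED)).add
      (((hσ.pow 2).mul hD).div ((IsSmoothGerm.mul (.const (2 : ℝ) _) hE).mul (hM.pow 2))
        h2EM)).div (hE.pow 2) hE02
    have dS := (((((dt2.mul hP.hasDerivAt).div (dE.mul dD) hED).add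
      ((dt2.mul hQ.hasDerivAt).div (dE.mul dD) hED)).add
      (((dσ.pow 2).mul dD).div ((dE.const_mul 2).mul (dM.pow 2)) h2EM))).div (dE.pow 2) hE02
    refine hS.isTermO_two ?_ (dS.congr_deriv ?_)
    · simp [E0, D0, k0]
    · simp [E0, D0, k0]
      field_simp
  · have hS := ((ht2.mul hκ.neg).div hE (by simp [E0])).add
      ((hσ.mul (hD.pow 2)).div (hE.mul (hM.pow 2)) hEM)
    have dS := (((dt2.mul hκ.neg.hasDerivAt).div dE (by simp [E0]))).add
      ((dσ.mul (dD.pow 2)).div (dE.mul (dM.pow 2)) hEM)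
    refine hS.isTermO_two ?_ (dS.congr_deriv ?_)
    · simp [E0, D0, k0]
    · simp [E0, D0, k0]
      field_simp
  · have hS := ((IsSmoothGerm.mul (.const (2 : ℝ) _) hE).mul (hD.pow 3)).div (hM.pow 2)
      (pow_ne_zero 2 M0)
    exact hS.isTermO_one (by simp [E0, D0])


namespace NormalForm

variable (N : NormalForm)

/-- The second derivative of a restricted component along a curve `(u(t), -t²)`. -/
theorem hasDerivAt_fderiv_fderiv_along {α : ℝ → ℝ} {β : ℝ × ℝ → ℝ} (hα : IsSmoothGerm α 0)
    (hβ : IsSmoothGerm β 0) {u : ℝ → ℝ} (hu : IsSmoothGerm u 0) (hu0 : u 0 = 0) {u' : ℝ}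
    (hud : HasDerivAt u u' 0) :
    HasDerivAt (fun t : ℝ => fderiv ℝ (fderiv ℝ fun q : ℝ × ℝ =>
        q.1 ^ 2 * α q.1 + q.1 * q.2 * β q) (u t, -t ^ 2) (1, 0) (1, 0))
      (6 * deriv α 0 * u') 0 := by
  obtain ⟨K, hK, he⟩ := exists_fderiv_fderiv_sq_mul_add hα hβ
  have hγ : IsSmoothGerm (fun t : ℝ => (u t, -t ^ 2)) 0 :=
    hu.prodMk (ContDiff.isSmoothGerm (by fun_prop) 0)
  have hγ0 : (u 0, -(0 : ℝ) ^ 2) = 0 := by simp [hu0]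
  have hγt : Tendsto (fun t : ℝ => (u t, -t ^ 2)) (𝓝 0) (𝓝 0) := by
    have := hγ.continuousAt
    rwa [ContinuousAt, hγ0] at this
  have hneg2 : HasDerivAt (fun t : ℝ => -t ^ 2) 0 0 :=
    (hasDerivAt_pow 2 (0 : ℝ)).neg.congr_deriv (by simp)
  have d0 := HasDerivAt.comp_of_eq (0 : ℝ) hα.hasDerivAt hud hu0.symm
  have d1 := HasDerivAt.comp_of_eq (0 : ℝ) hα.deriv.hasDerivAt hud hu0.symm
  have d2 := HasDerivAt.comp_of_eq (0 : ℝ) hα.deriv.deriv.hasDerivAt hud hu0.symm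
  have d3 := (hK.comp' hγ hγ0).hasDerivAt
  have H := (((d0.const_mul 2).add ((hud.const_mul 4).mul d1)).add ((hud.pow 2).mul d2)).add
    (hneg2.mul d3)
  refine HasDerivAt.congr_of_eventuallyEq (H.congr_deriv ?_) (hγt.eventually he)
  simp [hu0]
  ring

theorem fderiv_fderiv_sq_mul_add_zero {α : ℝ → ℝ} {β : ℝ × ℝ → ℝ} (hα : IsSmoothGerm α 0)
    (hβ : IsSmoothGerm β 0) :
    fderiv ℝ (fderiv ℝ fun q : ℝ × ℝ => q.1 ^ 2 * α q.1 + q.1 * q.2 * β q) 0 (1, 0) (1, 0) =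
      2 * α 0 := by
  obtain ⟨K, hK, he⟩ := exists_fderiv_fderiv_sq_mul_add hα hβ
  simpa using he.self_of_nhds

theorem fderiv_sq_mul_add_zero {α : ℝ → ℝ} {β : ℝ × ℝ → ℝ} (hα : IsSmoothGerm α 0)
    (hβ : IsSmoothGerm β 0) :
    fderiv ℝ (fun q : ℝ × ℝ => q.1 ^ 2 * α q.1 + q.1 * q.2 * β q) 0 (1, 0) = 0 := by
  simpa using (fderiv_sq_mul_add hα hβ).self_of_nhds

/-- `-t²` has derivative zero at `0` and `v` stays `0`, so only the partial derivative in `u`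
enters. -/
theorem hasDerivAt_f32_along {u : ℝ → ℝ} (hu0 : u 0 = 0) {u' : ℝ} (hud : HasDerivAt u u' 0) :
    HasDerivAt (fun t : ℝ => N.f32 (u t, 0, -t ^ 2)) (N.d1 * u') 0 := by
  have hneg2 : HasDerivAt (fun t : ℝ => -t ^ 2) 0 0 :=
    (hasDerivAt_pow 2 (0 : ℝ)).neg.congr_deriv (by simp)
  have hd := N.smooth32.differentiableAt.hasFDerivAt
  have h1 : HasDerivAt (fun r : ℝ => N.f32 (r, 0, 0)) (fderiv ℝ N.f32 0 (1, 0, 0)) 0 :=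
    HasFDerivAt.comp_hasDerivAt (f := fun r : ℝ => (r, ((0 : ℝ), (0 : ℝ)))) (0 : ℝ) hd
      ((hasDerivAt_id (0 : ℝ)).prodMk (hasDerivAt_const _ _))
  have h2 : HasDerivAt (fun t : ℝ => N.f32 (u t, 0, -t ^ 2)) (fderiv ℝ N.f32 0 (u', 0, 0)) 0 :=
    HasFDerivAt.comp_hasDerivAt (f := fun t : ℝ => (u t, ((0 : ℝ), -t ^ 2))) (0 : ℝ)
      (by rw [hu0, zero_pow two_ne_zero, neg_zero]; exact hd) (hud.prodMk ((hasDerivAt_const _ _).prodMk hneg2))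
  refine h2.congr_deriv ?_
  rw [d1, h1.deriv, show ((u', 0, 0) : ℝ × ℝ × ℝ) = u' • ((1 : ℝ), (0 : ℝ), (0 : ℝ)) by simp,
    map_smul, smul_eq_mul, mul_comm]

end NormalForm

end

/-! ### Singular points, Whitney's criterion and expansions combined -/

theorem theorem3p6 (N : NormalForm) (c20 : ℝ) (hc20 : c20 ≠ 0) (hc2 : N.c2 = c20 ^ 2) :
    ∃ u : ℝ → ℝ,
      -- the curve `u` of singular points
      IsSmoothGerm u 0 ∧ u 0 = 0 ∧ HasDerivAt u (1 / c20) 0 ∧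
      (∀ᶠ q : ℝ × (ℝ × ℝ) in 𝓝 0,
        IsSingularPoint (N.map (-q.1 ^ 2)) q.2 ↔ q.2 = (u q.1, 0) ∨ q.2 = (u (-q.1), 0)) ∧
      (∀ᶠ t in 𝓝[≠] (0 : ℝ), u t ≠ u (-t) ∧ IsWhitneyUmbrella (N.map (-t ^ 2)) (u t, 0)) ∧
      -- the invariants along the curve and their expansions
      ∃ a20 a11 a02 : ℝ → ℝ,
        (∀ᶠ t in 𝓝[≠] (0 : ℝ), ∀ x y z : ℝ,
          HasBruceWestInvariants (N.map (-t ^ 2)) (u t, 0) x y z ↔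
            x = a20 t ∧ y = a11 t ∧ z = a02 t) ∧
        (∃ R : ℝ → ℝ, IsTermO 2 R ∧ ∀ᶠ t in 𝓝[≠] (0 : ℝ),
          a20 t = 1 / t ^ 2 * (N.f31 0 ^ 2 / (2 * c20 ^ 2)
            - N.f31 0 * (N.f31 0 * N.c3 - c20 ^ 2 * (3 * deriv N.f31 0 - N.d1 * N.f21 0))
                / c20 ^ 5 * t + R t)) ∧
        (∃ R : ℝ → ℝ, IsTermO 2 R ∧ ∀ᶠ t in 𝓝[≠] (0 : ℝ),
          a11 t = 1 / t ^ 2 * (N.f31 0 / (2 * c20 ^ 2)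
            - (2 * N.c3 * N.f31 0 - c20 ^ 2 * (3 * deriv N.f31 0 - N.d1 * N.f21 0))
                / (2 * c20 ^ 5) * t + R t)) ∧
        (∃ R : ℝ → ℝ, IsTermO 1 R ∧ ∀ᶠ t in 𝓝[≠] (0 : ℝ),
          a02 t = 1 / t ^ 2 * (1 / (2 * c20 ^ 2) + R t)) := by
  obtain ⟨u, M, hu, hM, hu0, hud, hzero, hm, hM0, dM⟩ := N.exists_singular_curve hc20 hc2
  have hγ : IsSmoothGerm (fun t : ℝ => (u t, -t ^ 2)) 0 :=
    hu.prodMk (ContDiff.isSmoothGerm (by fun_prop) 0)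
  have hδ : IsSmoothGerm (fun t : ℝ => (u t, (0 : ℝ), -t ^ 2)) 0 :=
    hu.prodMk (ContDiff.isSmoothGerm (by fun_prop) 0)
  have hγ0 : (u 0, -(0 : ℝ) ^ 2) = 0 := by simp [hu0]
  have hδ0 : (u 0, (0 : ℝ), -(0 : ℝ) ^ 2) = 0 := by simp [hu0]
  have hγt : Tendsto (fun t : ℝ => (u t, -t ^ 2)) (𝓝 0) (𝓝 0) := by
    have := hγ.continuousAt
    rwa [ContinuousAt, hγ0] at this
  have hδt : Tendsto (fun t : ℝ => (u t, (0 : ℝ), -t ^ 2)) (𝓝 0) (𝓝 0) := by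
    have := hδ.continuousAt
    rwa [ContinuousAt, hδ0] at this
  -- the coefficients of the 2-jet along the curve
  let g1 : ℝ → ℝ := fun t => fderiv ℝ N.axis2 (u t, -t ^ 2) (1, 0)
  let g2 : ℝ → ℝ := fun t => fderiv ℝ (fderiv ℝ N.axis2) (u t, -t ^ 2) (1, 0) (1, 0)
  let h1 : ℝ → ℝ := fun t => fderiv ℝ N.axis3 (u t, -t ^ 2) (1, 0)
  let h2 : ℝ → ℝ := fun t => fderiv ℝ (fderiv ℝ N.axis3) (u t, -t ^ 2) (1, 0) (1, 0)
  let k : ℝ → ℝ := fun t => N.f32 (u t, 0, -t ^ 2)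
  -- The second derivative is rewritten near `0` as an iterated partial derivative, to which the
  -- rules for smooth germs apply.
  have hsnd : ∀ {F : ℝ × ℝ → ℝ}, IsSmoothGerm F 0 →
      IsSmoothGerm (fun q => fderiv ℝ (fderiv ℝ F) q (1, 0) (1, 0)) 0 := fun hF =>
    ((hF.fderiv_apply (1, 0)).fderiv_apply (1, 0)).congr
      (hF.eventually_isSmoothGerm.mono fun q hq => hq.fderiv_fderiv_apply _ _)
  have hg1 : IsSmoothGerm g1 0 := (N.smooth_axis2.fderiv_apply (1, 0)).comp' hγ hγ0
  have hh1 : IsSmoothGerm h1 0 := (N.smooth_axis3.fderiv_apply (1, 0)).comp' hγ hγ0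
  have hg2 : IsSmoothGerm g2 0 := (hsnd N.smooth_axis2).comp' hγ hγ0
  have hh2 : IsSmoothGerm h2 0 := (hsnd N.smooth_axis3).comp' hγ hγ0
  have hk : IsSmoothGerm k 0 := N.smooth32.comp' hδ hδ0
  have g10 : g1 0 = 0 := by
    simp only [g1, hγ0]
    exact NormalForm.fderiv_sq_mul_add_zero N.smooth21 N.smooth24
  have h10 : h1 0 = 0 := by
    simp only [h1, hγ0]
    exact NormalForm.fderiv_sq_mul_add_zero N.smooth31 N.smooth34
  have g20 : g2 0 = 2 * N.f21 0 := by
    simp only [g2, hγ0]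
    exact NormalForm.fderiv_fderiv_sq_mul_add_zero N.smooth21 N.smooth24
  have h20 : h2 0 = 2 * N.f31 0 := by
    simp only [h2, hγ0]
    exact NormalForm.fderiv_fderiv_sq_mul_add_zero N.smooth31 N.smooth34
  have k0 : k 0 = 0 := by
    simp only [k, hδ0]
    exact N.f32_zero
  have dh2 : HasDerivAt h2 (6 * deriv N.f31 0 * (1 / c20)) 0 :=
    NormalForm.hasDerivAt_fderiv_fderiv_along N.smooth31 N.smooth34 hu hu0 hud
  have dk : HasDerivAt k (N.d1 * (1 / c20)) 0 := N.hasDerivAt_f32_along hu0 hud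
  have hM0' : M 0 ≠ 0 := by rw [hM0]; exact mul_ne_zero two_ne_zero hc20
  obtain ⟨E, D, hE, hD, hE2, hD2, R20, R11, R02⟩ := umbrella_expansions hg1 hg2 hh1 hh2 hk hM
    g10 h10 k0 hM0' dh2 dk dM
  -- the 2-jet at the points of the curve
  have hjet : ∀ᶠ t in 𝓝[≠] (0 : ℝ), IsSmoothGerm (N.map (-t ^ 2)) (u t, 0) ∧
      HasUmbrellaJet (N.map (-t ^ 2)) (u t, 0) (g1 t) (g2 t) (h1 t) (h2 t) (t * M t) (k t) ∧
      M t ≠ 0 := by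
    have hz : ∀ᶠ t in 𝓝 (0 : ℝ), N.f33 (u t, -t ^ 2) = 0 := by
      have ht : Tendsto (fun t : ℝ => (t, u t)) (𝓝 0) (𝓝 0) := by
        have := (IsSmoothGerm.prodMk (.id (0 : ℝ)) hu).continuousAt
        rwa [ContinuousAt, hu0] at this
      filter_upwards [ht.eventually hzero] with t h
      exact h.2 (Or.inl rfl)
    refine nhdsWithin_le_nhds ?_
    filter_upwards [hz, hm, hM.continuousAt.eventually_ne hM0',
      hγt.eventually N.smooth_axis2.eventually_isSmoothGerm,
      hγt.eventually N.smooth_axis3.eventually_isSmoothGerm,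
      hδt.eventually N.smooth32.eventually_isSmoothGerm,
      hγt.eventually N.smooth33.eventually_isSmoothGerm] with t e1 e2 e3 e4 e5 e6 e7
    refine ⟨N.isSmoothGerm_map e4 e5 e6 e7, ?_, e3⟩
    rw [← e2]
    exact N.hasUmbrellaJet_map e4 e5 e6 e7 e1
  refine ⟨u, hu, hu0, hud, ?_, ?_, ?_⟩
  -- The neighbourhood is one of `(t, (u, v))` jointly, so all smoothness conditions are pulled back
  -- to that space.
  · have ht2 : Tendsto (fun q : ℝ × (ℝ × ℝ) => (q.2.1, -q.1 ^ 2)) (𝓝 0) (𝓝 0) := by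
      have : ContinuousAt (fun q : ℝ × (ℝ × ℝ) => (q.2.1, -q.1 ^ 2)) 0 := by fun_prop
      have h0 : ((0 : ℝ), -(0 : ℝ) ^ 2) = 0 := by simp
      exact this.tendsto.mono_right (congrArg 𝓝 h0).le
    have ht3 : Tendsto (fun q : ℝ × (ℝ × ℝ) => (q.2.1, q.2.2, -q.1 ^ 2)) (𝓝 0) (𝓝 0) := by
      have : ContinuousAt (fun q : ℝ × (ℝ × ℝ) => (q.2.1, q.2.2, -q.1 ^ 2)) 0 := by fun_prop
      have h0 : ((0 : ℝ), (0 : ℝ), -(0 : ℝ) ^ 2) = 0 := by simp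
      exact this.tendsto.mono_right (congrArg 𝓝 h0).le
    have ht : Tendsto (fun q : ℝ × (ℝ × ℝ) => (q.1, q.2.1)) (𝓝 0) (𝓝 0) := by
      have : ContinuousAt (fun q : ℝ × (ℝ × ℝ) => (q.1, q.2.1)) 0 := by fun_prop
      exact this
    filter_upwards [ht2.eventually N.smooth_axis2.eventually_isSmoothGerm,
      ht2.eventually N.smooth_axis3.eventually_isSmoothGerm,
      ht3.eventually N.smooth32.eventually_isSmoothGerm,
      ht2.eventually N.smooth33.eventually_isSmoothGerm, ht.eventually hzero] with q e1 e2 e3 e4 e5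
    rw [N.isSingularPoint_map_iff e1 e2 e3 e4, e5, Prod.ext_iff, Prod.ext_iff]
    tauto
  -- `u(t) - u(-t)` has derivative `2 / c20 ≠ 0` at `0`, so it vanishes at no nearby `t ≠ 0`.
  · have hne : ∀ᶠ t in 𝓝[≠] (0 : ℝ), u t - u (-t) ≠ 0 := by
      have d : HasDerivAt (fun t => u t - u (-t)) (2 / c20) 0 := by
        have d1 : HasDerivAt (fun t => u (-t)) (1 / c20 * -1) 0 :=
          HasDerivAt.comp_of_eq (0 : ℝ) hud (hasDerivAt_neg 0) (by simp)
        exact (hud.sub d1).congr_deriv (by ring)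
      simpa using d.eventually_ne (c := 0) (div_ne_zero two_ne_zero hc20)
    filter_upwards [hne, hjet, self_mem_nhdsWithin] with t e1 e2 e3
    exact ⟨sub_ne_zero.1 e1, e2.2.1.isWhitneyUmbrella e2.1 (mul_ne_zero e3 e2.2.2)⟩
  -- The invariants of the 2-jet with `m = t M(t)`.
  refine ⟨fun t => ((g2 t * (1 + h1 t ^ 2 - k t * g1 t * h1 t)
        + h2 t * (k t - g1 t * h1 t + k t * g1 t ^ 2)) / (E t * D t)
      + (k t * g2 t - h2 t) * (k t - g1 t * h1 t + k t * g1 t ^ 2) / (E t * D t)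
      + (h2 t - k t * g2 t) ^ 2 * D t / (2 * E t * (t * M t) ^ 2)) / E t ^ 2,
    fun t => -(k t - g1 t * h1 t + k t * g1 t ^ 2) / E t
      + (h2 t - k t * g2 t) * D t ^ 2 / (E t * (t * M t) ^ 2),
    fun t => 2 * E t * D t ^ 3 / (t * M t) ^ 2, ?_, ⟨_, R20, ?_⟩, ⟨_, R11, ?_⟩, ⟨_, R02, ?_⟩⟩
  · filter_upwards [hjet, self_mem_nhdsWithin] with t e1 e2 x y z
    have hm0 : t * M t ≠ 0 := mul_ne_zero e2 e1.2.2
    exact ⟨fun h => h.eq_of_hasUmbrellaJet e1.2.1 hm0 (hE t) (hD t) (hE2 t) (hD2 t),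
      fun h => e1.2.1.hasBruceWestInvariants e1.1 hm0 (hE t) (hD t) (hE2 t) (hD2 t)
        h.1 h.2.1 h.2.2⟩
  -- The remainder in `R20` is `t² a20(t)` minus its first-order Taylor polynomial, so the expansion
  -- is an algebraic identity for `t ≠ 0`. The other two are obtained likewise.
  · filter_upwards [hjet, self_mem_nhdsWithin] with t e1 e2
    have hMt := e1.2.2
    have ht : t ≠ 0 := e2
    have hEt := (hE t).ne'
    have hDt := (hD t).ne'
    simp only [h20, g20, hM0]
    field_simp
    ring
  · filter_upwards [hjet, self_mem_nhdsWithin] with t e1 e2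
    have hMt := e1.2.2
    have ht : t ≠ 0 := e2
    have hEt := (hE t).ne'
    have hDt := (hD t).ne'
    simp only [h20, g20, hM0]
    field_simp
    ring
  · filter_upwards [hjet, self_mem_nhdsWithin] with t e1 e2
    have hMt := e1.2.2
    have ht : t ≠ 0 := e2
    simp only [hM0]
    field_simp
    ring
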